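/- All Lie groups are modelled on real Hausdorff locally convex spaces. For locally convex spaces $E,F$ and $U\subseteq E$ open, a map $f:U\to F$ is of class $C^k$ ($k\in\mathbb N_0\cup\{\infty\}$) if it is continuous and its iterated directional derivatives $d^jf(x)(h_1,\dots,h_j)=(\partial_{h_j}\cdots\partial_{h_1}f)(x)$, $1\le j\le k$, exist and define continuous maps $U\times E^j\to F$; smooth means $C^\infty$. A Lie group $G$ is a group that is a Hausdorff smooth manifold modelled on a locally convex space, with smooth multiplication and inversion; $\mathfrak g=T_{\mathbf 1}(G)$. An exponential function of $G$ is a smooth map $\exp_G:\mathfrak g\to G$ such that, for each $x\in\mathfrak g$, the curve $\gamma_x(t)=\exp_G(tx)$ is a one-parameter group with $\gamma_x'(0)=x$. The group $G$ is locally exponential if it has an exponential function that maps some open $0$-neighbourhood in $\mathfrak g$ diffeomorphically onto an open subset of $G$. It has the Trotter property if it has an exponential function and, for all $x_1,x_2\in\mathfrak g$, $$\exp_G(t(x_1+x_2))=\lim_{n\to\infty}\Big(\exp_G\big(\tfrac tn x_1\big)\exp_G\big(\tfrac tn x_2\big)\Big)^n$$ uniformly for $t$ in compact subsets of $\mathbb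 R$; here $\gamma_n\to\gamma$ uniformly on $S$ means that for every neighbourhood $W$ of $\mathbf 1$ one has $\gamma(t)^{-1}\gamma_n(t)\in W$ for all $t\in S$ and all sufficiently large $n$. (1) Every locally exponential Lie group has the Trotter property. (2) Let $M$ be a compact finite-dimensional smooth manifold (without boundary), $K$ a locally exponential Lie group with Lie algebra $\mathfrak k$ and exponential function $\exp_K$ that is a local diffeomorphism at $0$, and $r\in\mathbb N_0\cup\{\infty\}$. Then the set $C^r(M,K)$ is a group under pointwise multiplication, and it carries a Lie group structure modelled on the locally convex space $C^r(M,\mathfrak k)$ (with the compact-open $C^r$-topology) for which $\xi\mapsto\exp_K\circ\xi$ is an exponential function $C^r(M,\mathfrak k)\to C^r(M,K)$ mapping some open $0$-neighbourhood diffeomorphically onto an open subset. With this structure the mapping group $C^r(M,K)$ is locally exponential and has the Trotter property. (3) In particular, for $K$ and $r$ as in (2), the loop group $C^r(\mathbb S^1,K)$, with the Lie group structure of (2), has the Trotter property. -/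

import Mathlib

open Set Filter Topology
open scoped Manifold ContDiff

set_option linter.unusedSectionVars false

noncomputable section

/-! ### Differential calculus between (locally convex) topological vector spaces -/

section Calculus

variable {E F : Type*} [AddCommGroup E] [Module ℝ E] [TopologicalSpace E]
  [AddCommGroup F] [Module ℝ F] [TopologicalSpace F]

/-- `y` is the derivative of `f` at `x` in the direction `h`, i.e. the limit of
`(f (x + t h) - f x) / t` as `t → 0`, `t ≠ 0`. -/
def HasDirDeriv (f : E → F) (x h : E) (y : F) : Prop :=
  Tendsto (fun t : ℝ => t⁻¹ • (f (x + t • h) - f x)) (𝓝[≠] 0) (𝓝 y)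

/-- The directional derivative `∂_h f (x)` (a junk value if it does not exist). -/
def dirDeriv (f : E → F) (x h : E) : F :=
  limUnder (𝓝[≠] (0 : ℝ)) (fun t : ℝ => t⁻¹ • (f (x + t • h) - f x))

/-- The iterated directional derivative
`d^j f (x) (h_1, …, h_j) = (∂_{h_j} ⋯ ∂_{h_1} f) (x)`. -/
def iterDirDeriv : (j : ℕ) → (E → F) → E → (Fin j → E) → F
  | 0, f, x, _ => f x
  | j + 1, f, x, h => dirDeriv (fun z => iterDirDeriv j f z (Fin.init h)) x (h (Fin.last j))

/-- `f` is of class `C^k`, `k ∈ ℕ₀ ∪ {∞}`, on the open set `U`: the iterated directional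
derivatives of order `≤ k` exist at all points of `U` in all directions, and the maps
`d^j f : U × E^j → F`, `0 ≤ j ≤ k` (with `d^0 f = f`), are continuous. -/
structure IsCkOn (k : ℕ∞) (f : E → F) (U : Set E) : Prop where
  exists_deriv : ∀ j : ℕ, (j : ℕ∞) < k → ∀ x ∈ U, ∀ h : Fin (j + 1) → E,
    ∃ y : F, HasDirDeriv (fun z => iterDirDeriv j f z (Fin.init h)) x (h (Fin.last j)) y
  continuousOn : ∀ j : ℕ, (j : ℕ∞) ≤ k →
    ContinuousOn (fun p : E × (Fin j → E) => iterDirDeriv j f p.1 p.2) (U ×ˢ univ)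

end Calculus

/-! ### Manifolds and Lie groups modelled on locally convex spaces -/

section Manifolds

/-- `f : M → N` is of class `C^k` on the open set `S ⊆ M`: it is continuous there, and all its
representatives in charts are `C^k`. Here `M` is modelled on `E` and `N` on `F`. -/
structure IsCkMapOn (E : Type*) [AddCommGroup E] [Module ℝ E] [TopologicalSpace E]
    {M : Type*} [TopologicalSpace M] [ChartedSpace E M]
    (F : Type*) [AddCommGroup F] [Module ℝ F] [TopologicalSpace F]
    {N : Type*} [TopologicalSpace N] [ChartedSpace F N]
    (k : ℕ∞) (f : M → N) (S : Set M) : Prop where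
  continuousOn : ContinuousOn f S
  isCkOn : ∀ φ ∈ atlas E M, ∀ ψ ∈ atlas F N,
    IsCkOn k (fun x => ψ (f (φ.symm x))) (φ.target ∩ φ.symm ⁻¹' (S ∩ f ⁻¹' ψ.source))

variable (E : Type*) [AddCommGroup E] [Module ℝ E] [TopologicalSpace E]

/-- A Lie group modelled on the (real, Hausdorff) locally convex space `E`: a Hausdorff smooth
manifold modelled on `E` with a group structure whose multiplication and inversion are smooth. -/
structure IsLCLieGroup [IsTopologicalAddGroup E] [ContinuousSMul ℝ E] [LocallyConvexSpace ℝ E]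
    [T2Space E] (G : Type*) [Group G] [TopologicalSpace G] [ChartedSpace E G] : Prop where
  t2 : T2Space G
  smooth_compat : ∀ φ ∈ atlas E G, ∀ ψ ∈ atlas E G,
    IsCkOn ⊤ (fun x => ψ (φ.symm x)) (φ.target ∩ φ.symm ⁻¹' ψ.source)
  smooth_mul : letI : ChartedSpace (E × E) (G × G) := prodChartedSpace E G E G
    IsCkMapOn (E × E) E ⊤ (fun p : G × G => p.1 * p.2) univ
  smooth_inv : IsCkMapOn E E ⊤ (fun g : G => g⁻¹) univ

variable {E} {G : Type*} [Group G] [TopologicalSpace G] [ChartedSpace E G]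

/-- `exp` is an exponential function of `G`. The tangent space of `G` at `1` is identified with
`E` by means of the preferred chart at `1`, as is usual in Mathlib. -/
structure IsExpFunction (exp : E → G) : Prop where
  smooth : IsCkMapOn E E ⊤ exp univ
  map_add : ∀ (x : E) (s t : ℝ), exp ((s + t) • x) = exp (s • x) * exp (t • x)
  deriv : ∀ x : E, HasDirDeriv (fun y => chartAt E (1 : G) (exp y)) 0 x x

/-- `exp` maps some open `0`-neighbourhood diffeomorphically onto an open subset of `G`. -/
def IsLocalDiffeoAtZero (exp : E → G) : Prop :=
  ∃ U : Set E, IsOpen U ∧ (0 : E) ∈ U ∧ IsOpen (exp '' U) ∧ IsCkMapOn E E ⊤ exp U ∧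
    ∃ log : G → E, (∀ x ∈ U, log (exp x) = x) ∧ IsCkMapOn E E ⊤ log (exp '' U)

variable (E G)

/-- `G` is locally exponential. -/
def IsLocallyExponential : Prop :=
  ∃ exp : E → G, IsExpFunction exp ∧ IsLocalDiffeoAtZero exp

/-- The Trotter property: `G` has a smooth exponential function, and
`exp (t (x + y)) = lim (exp (t/n x) exp (t/n y))^n`, uniformly for `t` in compact subsets
of `ℝ`. -/
def HasTrotterProperty : Prop :=
  ∃ exp : E → G, IsExpFunction exp ∧ ∀ x y : E, ∀ S : Set ℝ, IsCompact S →
    ∀ U ∈ 𝓝 (1 : G), ∀ᶠ n : ℕ in atTop, ∀ t ∈ S,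
      (exp (t • (x + y)))⁻¹ * (exp ((t / (n : ℝ)) • x) * exp ((t / (n : ℝ)) • y)) ^ n ∈ U

end Manifolds

/-! ### Spaces of `C^r` maps -/

/-- The set `C^r(M, N)`, where `M` is modelled on `F` and `N` on `E`. -/
@[ext]
structure CkMap (F : Type*) [AddCommGroup F] [Module ℝ F] [TopologicalSpace F]
    (M : Type*) [TopologicalSpace M] [ChartedSpace F M]
    (E : Type*) [AddCommGroup E] [Module ℝ E] [TopologicalSpace E]
    (N : Type*) [TopologicalSpace N] [ChartedSpace E N] (r : ℕ∞) where
  toFun : M → N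
  isCk : IsCkMapOn F E r toFun univ

section FunctionSpace

variable {E F : Type*} [AddCommGroup E] [Module ℝ E] [TopologicalSpace E]
  [AddCommGroup F] [Module ℝ F] [TopologicalSpace F]

lemma HasDirDeriv.dirDeriv_eq [T2Space F] {f : E → F} {x h : E} {y : F}
    (hf : HasDirDeriv f x h y) : dirDeriv f x h = y :=
  Tendsto.limUnder_eq hf

lemma HasDirDeriv.congr_of_eqOn [IsTopologicalAddGroup E] [ContinuousSMul ℝ E]
    {f g : E → F} {x h : E} {y : F} {U : Set E} (hU : IsOpen U) (hx : x ∈ U)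
    (hfg : EqOn g f U) (hf : HasDirDeriv f x h y) : HasDirDeriv g x h y := by
  have hc : Tendsto (fun t : ℝ => x + t • h) (𝓝[≠] 0) (𝓝 x) := by
    have : Continuous (fun t : ℝ => x + t • h) := by fun_prop
    have h0 := this.tendsto 0
    simp only [zero_smul, add_zero] at h0
    exact h0.mono_left nhdsWithin_le_nhds
  refine Tendsto.congr' ?_ hf
  filter_upwards [hc (hU.mem_nhds hx)] with t ht
  rw [hfg ht, hfg hx]

lemma HasDirDeriv.add [ContinuousAdd F] {f g : E → F} {x h : E} {y z : F}
    (hf : HasDirDeriv f x h y) (hg : HasDirDeriv g x h z) :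
    HasDirDeriv (fun w => f w + g w) x h (y + z) := by
  refine (Tendsto.add hf hg).congr fun t => ?_
  rw [← smul_add, sub_add_sub_comm]

lemma HasDirDeriv.const_smul [ContinuousSMul ℝ F] {f : E → F} {x h : E} {y : F} (c : ℝ)
    (hf : HasDirDeriv f x h y) : HasDirDeriv (fun w => c • f w) x h (c • y) := by
  refine (Tendsto.const_smul hf c).congr fun t => ?_
  rw [← smul_sub, smul_comm]

variable [IsTopologicalAddGroup E] [ContinuousSMul ℝ E] [T2Space F]
  {k : ℕ∞} {f g : E → F} {U : Set E}

lemma IsCkOn.hasDirDeriv (hf : IsCkOn k f U) {j : ℕ} (hj : (j : ℕ∞) < k) {x : E} (hx : x ∈ U)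
    (h : Fin (j + 1) → E) :
    HasDirDeriv (fun z => iterDirDeriv j f z (Fin.init h)) x (h (Fin.last j))
      (iterDirDeriv (j + 1) f x h) := by
  obtain ⟨y, hy⟩ := hf.exists_deriv j hj x hx h
  have : iterDirDeriv (j + 1) f x h = y := hy.dirDeriv_eq
  rwa [this]

lemma IsCkOn.iterDirDeriv_add [ContinuousAdd F] (hU : IsOpen U) (hf : IsCkOn k f U)
    (hg : IsCkOn k g U) : ∀ j : ℕ, (j : ℕ∞) ≤ k → ∀ x ∈ U, ∀ h : Fin j → E,
    iterDirDeriv j (fun w => f w + g w) x h = iterDirDeriv j f x h + iterDirDeriv j g x h := by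
  intro j
  induction j with
  | zero => intro _ x _ h; rfl
  | succ j ih =>
    intro hj x hx h
    have hj' : (j : ℕ∞) < k := lt_of_lt_of_le (by exact_mod_cast Nat.lt_succ_self j) hj
    exact (((hf.hasDirDeriv hj' hx h).add (hg.hasDirDeriv hj' hx h)).congr_of_eqOn hU hx
      (fun z hz => ih hj'.le z hz (Fin.init h))).dirDeriv_eq

lemma IsCkOn.iterDirDeriv_const_smul [ContinuousSMul ℝ F] (c : ℝ) (hU : IsOpen U)
    (hf : IsCkOn k f U) : ∀ j : ℕ, (j : ℕ∞) ≤ k → ∀ x ∈ U, ∀ h : Fin j → E,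
    iterDirDeriv j (fun w => c • f w) x h = c • iterDirDeriv j f x h := by
  intro j
  induction j with
  | zero => intro _ x _ h; rfl
  | succ j ih =>
    intro hj x hx h
    have hj' : (j : ℕ∞) < k := lt_of_lt_of_le (by exact_mod_cast Nat.lt_succ_self j) hj
    exact (((hf.hasDirDeriv hj' hx h).const_smul c).congr_of_eqOn hU hx
      (fun z hz => ih hj'.le z hz (Fin.init h))).dirDeriv_eq

lemma IsCkOn.add [ContinuousAdd F] (hU : IsOpen U) (hf : IsCkOn k f U) (hg : IsCkOn k g U) :
    IsCkOn k (fun w => f w + g w) U where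
  exists_deriv j hj _ hx h :=
    ⟨_, ((hf.hasDirDeriv hj hx h).add (hg.hasDirDeriv hj hx h)).congr_of_eqOn hU hx
      (fun z hz => hf.iterDirDeriv_add hU hg j hj.le z hz (Fin.init h))⟩
  continuousOn j hj := ((hf.continuousOn j hj).add (hg.continuousOn j hj)).congr
    fun p hp => hf.iterDirDeriv_add hU hg j hj p.1 hp.1 p.2

lemma IsCkOn.const_smul [ContinuousSMul ℝ F] (c : ℝ) (hU : IsOpen U) (hf : IsCkOn k f U) :
    IsCkOn k (fun w => c • f w) U where
  exists_deriv j hj _ hx h :=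
    ⟨_, ((hf.hasDirDeriv hj hx h).const_smul c).congr_of_eqOn hU hx
      (fun z hz => hf.iterDirDeriv_const_smul c hU j hj.le z hz (Fin.init h))⟩
  continuousOn j hj := ((hf.continuousOn j hj).const_smul c).congr
    fun p hp => hf.iterDirDeriv_const_smul c hU j hj p.1 hp.1 p.2

lemma iterDirDeriv_zero_fun : ∀ (j : ℕ) (x : E) (h : Fin j → E),
    iterDirDeriv j (fun _ : E => (0 : F)) x h = 0 := by
  intro j
  induction j with
  | zero => intro _ _; rfl
  | succ j ih =>
    intro x h
    refine HasDirDeriv.dirDeriv_eq ?_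
    simp only [HasDirDeriv, ih, sub_zero, smul_zero]
    exact tendsto_const_nhds

lemma isCkOn_zero : IsCkOn k (fun _ : E => (0 : F)) U where
  exists_deriv j _ x _ h := ⟨0, by
    simp only [HasDirDeriv, iterDirDeriv_zero_fun, sub_zero, smul_zero]
    exact tendsto_const_nhds⟩
  continuousOn j _ := by
    simp only [iterDirDeriv_zero_fun]
    exact continuousOn_const

end FunctionSpace

namespace CkMap

section Basic

variable {F : Type*} [AddCommGroup F] [Module ℝ F] [TopologicalSpace F]
  {M : Type*} [TopologicalSpace M] [ChartedSpace F M]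
  {E : Type*} [AddCommGroup E] [Module ℝ E] [TopologicalSpace E]
  {N : Type*} [TopologicalSpace N] [ChartedSpace E N] {r : ℕ∞}

instance : FunLike (CkMap F M E N r) M N where
  coe := toFun
  coe_injective _ _ h := CkMap.ext h

end Basic

/-! The locally convex space `C^r(M, E)`, with pointwise operations and the
compact-open `C^r`-topology. -/

variable {F : Type*} [AddCommGroup F] [Module ℝ F] [TopologicalSpace F]
  [IsTopologicalAddGroup F] [ContinuousSMul ℝ F]
  {M : Type*} [TopologicalSpace M] [ChartedSpace F M]
  {E : Type*} [AddCommGroup E] [Module ℝ E] [TopologicalSpace E]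
  [IsTopologicalAddGroup E] [ContinuousSMul ℝ E] [T2Space E] {r : ℕ∞}

lemma isCkMapOn_vector_iff {f : M → E} : IsCkMapOn F E r f univ ↔
    Continuous f ∧ ∀ φ ∈ atlas F M, IsCkOn r (fun x => f (φ.symm x)) φ.target := by
  constructor
  · intro h
    refine ⟨continuousOn_univ.1 h.continuousOn, fun φ hφ => ?_⟩
    simpa using h.isCkOn φ hφ (OpenPartialHomeomorph.refl E) (by simp)
  · rintro ⟨h1, h2⟩
    refine ⟨continuousOn_univ.2 h1, fun φ hφ ψ hψ => ?_⟩
    rw [chartedSpaceSelf_atlas] at hψ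
    subst hψ
    simpa using h2 φ hφ

instance : Zero (CkMap F M E E r) where
  zero := ⟨fun _ => 0, isCkMapOn_vector_iff.2 ⟨continuous_const, fun _ _ => isCkOn_zero⟩⟩

instance : Add (CkMap F M E E r) where
  add f g := ⟨fun m => f m + g m, by
    obtain ⟨f1, f2⟩ := isCkMapOn_vector_iff.1 f.isCk
    obtain ⟨g1, g2⟩ := isCkMapOn_vector_iff.1 g.isCk
    exact isCkMapOn_vector_iff.2
      ⟨f1.add g1, fun φ hφ => (f2 φ hφ).add φ.open_target (g2 φ hφ)⟩⟩

instance : SMul ℝ (CkMap F M E E r) where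
  smul c f := ⟨fun m => c • f m, by
    obtain ⟨f1, f2⟩ := isCkMapOn_vector_iff.1 f.isCk
    exact isCkMapOn_vector_iff.2
      ⟨f1.const_smul c, fun φ hφ => (f2 φ hφ).const_smul c φ.open_target⟩⟩

instance : Neg (CkMap F M E E r) where
  neg f := ⟨fun m => -f m, by
    have h : (fun m => -f m) = fun m => (-1 : ℝ) • f m := by
      funext m
      rw [neg_smul, one_smul]
    rw [h]
    exact ((-1 : ℝ) • f).isCk⟩

@[simp] lemma zero_apply (m : M) : (0 : CkMap F M E E r) m = 0 := rfl

@[simp] lemma add_apply (f g : CkMap F M E E r) (m : M) : (f + g) m = f m + g m := rfl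

@[simp] lemma smul_apply (c : ℝ) (f : CkMap F M E E r) (m : M) : (c • f) m = c • f m := rfl

@[simp] lemma neg_apply (f : CkMap F M E E r) (m : M) : (-f) m = -f m := rfl

instance : AddCommGroup (CkMap F M E E r) where
  add_assoc _ _ _ := DFunLike.ext _ _ fun _ => add_assoc _ _ _
  zero_add _ := DFunLike.ext _ _ fun _ => zero_add _
  add_zero _ := DFunLike.ext _ _ fun _ => add_zero _
  neg_add_cancel _ := DFunLike.ext _ _ fun _ => neg_add_cancel _
  add_comm _ _ := DFunLike.ext _ _ fun _ => add_comm _ _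
  nsmul := nsmulRec
  zsmul := zsmulRec

instance : Module ℝ (CkMap F M E E r) where
  one_smul _ := DFunLike.ext _ _ fun _ => one_smul _ _
  mul_smul _ _ _ := DFunLike.ext _ _ fun _ => mul_smul _ _ _
  smul_zero _ := DFunLike.ext _ _ fun _ => smul_zero _
  zero_smul _ := DFunLike.ext _ _ fun _ => zero_smul _ _
  smul_add _ _ _ := DFunLike.ext _ _ fun _ => smul_add _ _ _
  add_smul _ _ _ := DFunLike.ext _ _ fun _ => add_smul _ _ _

/-- In the chart `φ` of `M`, with image `V ⊆ F`, the linear map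
`f ↦ d^j (f ∘ φ⁻¹) ∈ C(V × F^j, E)`, for `j ≤ r`. -/
def chartDeriv (φ : atlas F M) (j : {j : ℕ // (j : ℕ∞) ≤ r}) :
    CkMap F M E E r →ₗ[ℝ] C(φ.1.target × (Fin j.1 → F), E) where
  toFun f := ⟨fun p => iterDirDeriv j.1 (fun x => f (φ.1.symm x)) (p.1 : F) p.2,
    (((isCkMapOn_vector_iff.1 f.isCk).2 φ.1 φ.2).continuousOn j.1 j.2).comp_continuous
      (f := fun p : φ.1.target × (Fin j.1 → F) => ((p.1 : F), p.2))
      (by fun_prop) (fun p => ⟨p.1.2, mem_univ _⟩)⟩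
  map_add' f g := ContinuousMap.ext fun p =>
    ((isCkMapOn_vector_iff.1 f.isCk).2 φ.1 φ.2).iterDirDeriv_add φ.1.open_target
      ((isCkMapOn_vector_iff.1 g.isCk).2 φ.1 φ.2) j.1 j.2 p.1 p.1.2 p.2
  map_smul' c f := ContinuousMap.ext fun p =>
    ((isCkMapOn_vector_iff.1 f.isCk).2 φ.1 φ.2).iterDirDeriv_const_smul c φ.1.open_target
      j.1 j.2 p.1 p.1.2 p.2

/-- The compact-open `C^r`-topology on `C^r(M, E)`: the coarsest topology for which all the maps
`f ↦ d^j (f ∘ φ⁻¹) ∈ C(V × F^j, E)`, `j ≤ r`, `φ` a chart of `M` with image `V`, are continuous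
with respect to the compact-open topology on the target. -/
instance : TopologicalSpace (CkMap F M E E r) :=
  ⨅ (φ : atlas F M), ⨅ (j : {j : ℕ // (j : ℕ∞) ≤ r}),
    TopologicalSpace.induced (chartDeriv φ j) inferInstance

instance : IsTopologicalAddGroup (CkMap F M E E r) :=
  topologicalAddGroup_iInf fun φ => topologicalAddGroup_iInf fun j =>
    topologicalAddGroup_induced (chartDeriv φ j)

instance : ContinuousSMul ℝ (CkMap F M E E r) :=
  continuousSMul_iInf fun φ => continuousSMul_iInf fun j =>
    continuousSMul_induced (chartDeriv φ j)

instance [LocallyConvexSpace ℝ E] : LocallyConvexSpace ℝ (CkMap F M E E r) :=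
  LocallyConvexSpace.iInf fun φ => LocallyConvexSpace.iInf fun j =>
    LocallyConvexSpace.induced (chartDeriv φ j)

lemma continuous_chartDeriv (φ : atlas F M) (j : {j : ℕ // (j : ℕ∞) ≤ r}) :
    Continuous (chartDeriv (E := E) φ j) :=
  continuous_iff_le_induced.2 ((iInf_le _ φ).trans (iInf_le _ j))

instance : T2Space (CkMap F M E E r) := by
  refine T2Space.of_injective_continuous (f := fun f : CkMap F M E E r => (f : M → E))
    DFunLike.coe_injective (continuous_pi fun m => ?_)
  let p : (chartAt F m).target × (Fin 0 → F) :=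
    (⟨chartAt F m m, (chartAt F m).map_source (mem_chart_source F m)⟩, Fin.elim0)
  refine ((continuous_eval_const p).comp
    (continuous_chartDeriv ⟨chartAt F m, chart_mem_atlas F m⟩ ⟨0, by simp⟩)).congr fun f => ?_
  change f ((chartAt F m).symm (chartAt F m m)) = f m
  rw [(chartAt F m).left_inv (mem_chart_source F m)]

end CkMap

/-- A Lie group structure on the set `C^r(M, K)` that makes it the mapping group: the group
operation is pointwise multiplication, the Lie group is modelled on the locally convex space
`C^r(M, E)`, and the pointwise exponential `ξ ↦ exp ∘ ξ` is an exponential function which is a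
local diffeomorphism at `0`. (In particular the group topology is locally, via the
exponential function, the compact-open `C^r`-topology.) -/
structure IsMappingLieGroup {F : Type*} [AddCommGroup F] [Module ℝ F] [TopologicalSpace F]
    [IsTopologicalAddGroup F] [ContinuousSMul ℝ F]
    {M : Type*} [TopologicalSpace M] [ChartedSpace F M]
    {E : Type*} [AddCommGroup E] [Module ℝ E] [TopologicalSpace E]
    [IsTopologicalAddGroup E] [ContinuousSMul ℝ E] [LocallyConvexSpace ℝ E] [T2Space E]
    {K : Type*} [Group K] [TopologicalSpace K] [ChartedSpace E K] (exp : E → K) (r : ℕ∞)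
    [Group (CkMap F M E K r)] [TopologicalSpace (CkMap F M E K r)]
    [ChartedSpace (CkMap F M E E r) (CkMap F M E K r)] : Prop where
  mul_apply : ∀ (f g : CkMap F M E K r) (m : M), (f * g) m = f m * g m
  isLCLieGroup : IsLCLieGroup (CkMap F M E E r) (CkMap F M E K r)
  exists_exp : ∃ Exp : CkMap F M E E r → CkMap F M E K r,
    (∀ ξ m, Exp ξ m = exp (ξ m)) ∧ IsExpFunction Exp ∧ IsLocalDiffeoAtZero Exp

end

/-! Trotter property. Let `log` be a local inverse of `exp` at `1`. The curve `s ↦ log (exp (s x)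
exp (s y))` vanishes at `0` and has derivative `x + y` there (`IsLCLieGroup.tendsto_log_mul`). Hence
`b s = s⁻¹ log (exp (s x) exp (s y))` extends continuously to `s = 0` by `x + y`. For `s = t / n`
the `n`-th power of `exp (s x) exp (s y)` is `exp (n s b s) = exp (t b (t / n))`, which tends to
`exp (t (x + y))`; compactness of the range of `t` makes this uniform.

Mapping groups. If `exp` is invertible on `U`, the pointwise logarithm is a chart on the set of `f`
with values in `exp '' U`, and its left translates form an atlas. Chart changes, products, inverses
and the exponential function all become instances of one map, `(ξ, η) ↦ log (f exp ξ g exp η)` on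
`C^r(M, E) × C^r(M, E)`, so `LocalExpData` asks only for open domains and smoothness of these words.

Such a word is a pushforward `ξ ↦ h(·, ξ(·))`. Since `f` and `g` are merely `C^r`, `h` is not smooth
on `M × X`, but locally `h (m, y) = H (γ m, y)` with `H` smooth and `γ` of class `C^r`. The
fibrewise derivative of `h` has the same shape with the same `γ`, so induction on the order gives
smoothness (`CkMap.isCkOn_pushforward`) once the first directional derivative is found
(`CkMap.hasDirDeriv_pushforward`).

For that derivative, difference quotients must converge in the `C^r`-topology. Continuity of a map
`B → C^r(M, E)` is equivalent to its chart representatives being `C^r` families with derivatives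
jointly continuous in parameter and point (`IsCkFamilyOn`). The difference quotient of `H`,
completed at `t = 0` by the derivative, is such a family (`isCkFamilyOn_slopeMap`), and the chain
rule for families transports this to the pushforward. The analytic input throughout is a mean value
theorem with values in closed convex sets, obtained from Hahn–Banach. -/

noncomputable section

/-! ### The mean value theorem in locally convex spaces -/

section MeanValue

variable {A : Type*} [TopologicalSpace A]
  {E : Type*} [AddCommGroup E] [Module ℝ E] [TopologicalSpace E]
  [IsTopologicalAddGroup E] [ContinuousSMul ℝ E]
  {F : Type*} [AddCommGroup F] [Module ℝ F] [TopologicalSpace F]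
  [IsTopologicalAddGroup F] [ContinuousSMul ℝ F] [LocallyConvexSpace ℝ F]

lemma HasDirDeriv.hasDerivAt_comp {f : E → F} {x h : E} {y : F} {a : ℝ}
    (hf : HasDirDeriv f (x + a • h) h y) (l : F →L[ℝ] ℝ) :
    HasDerivAt (fun s : ℝ => l (f (x + s • h))) (l y) a := by
  rw [hasDerivAt_iff_tendsto_slope_zero]
  refine ((l.continuous.tendsto y).comp hf).congr fun t => ?_
  simp [add_smul, add_assoc]

/-- If a directional derivative along a segment takes values in a closed convex set, then so does
the difference quotient. -/
lemma slope_mem_of_hasDirDeriv {f : E → F} {x h : E} {t : ℝ} (ht : t ≠ 0) {f' : ℝ → F}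
    {C : Set F} (hC : IsClosed C) (hconv : Convex ℝ C)
    (hf : ∀ s ∈ Icc (0 : ℝ) 1, HasDirDeriv f (x + (s * t) • h) h (f' s))
    (hmem : ∀ s ∈ Icc (0 : ℝ) 1, f' s ∈ C) : t⁻¹ • (f (x + t • h) - f x) ∈ C := by
  by_contra hx
  -- A functional `l` separates the quotient strictly from `C`. By the scalar mean value theorem `l`
  -- takes the same value on the quotient as on some `f' c ∈ C`, a contradiction.
  obtain ⟨l, u, hl, hu⟩ := geometric_hahn_banach_closed_point hconv hC hx
  have hd : ∀ s ∈ Icc (0 : ℝ) 1,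
      HasDerivAt (fun s : ℝ => l (f (x + (s * t) • h))) (l (f' s) * t) s := by
    intro s hs
    exact HasDerivAt.comp (h₂ := fun r : ℝ => l (f (x + r • h))) s
      ((hf s hs).hasDerivAt_comp l) (by simpa using (hasDerivAt_id s).mul_const t)
  obtain ⟨c, hc, hc'⟩ := exists_hasDerivAt_eq_slope _ _ zero_lt_one
    (fun s hs => (hd s hs).continuousAt.continuousWithinAt)
    (fun s hs => hd s (Ioo_subset_Icc_self hs))
  have h1 := hl _ (hmem c (Ioo_subset_Icc_self hc))
  simp only [one_mul, zero_mul, zero_smul, add_zero, sub_zero, div_one] at hc'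
  rw [map_smul, map_sub, ← hc', smul_eq_mul, mul_comm, mul_assoc, mul_inv_cancel₀ ht, mul_one]
    at hu
  exact lt_asymm h1 hu

/-- Convexity is what the mean value theorem requires, closedness what keeps limits inside; the
closure of a convex neighbourhood contained in a closed one has both. -/
lemma exists_closed_convex_nhds {y : F} {N : Set F} (hN : N ∈ 𝓝 y) :
    ∃ C ∈ 𝓝 y, IsClosed C ∧ Convex ℝ C ∧ C ⊆ N := by
  obtain ⟨D, ⟨hD, hDc⟩, hDN⟩ := (closed_nhds_basis y).mem_iff.1 hN
  obtain ⟨V, ⟨hV, hVc⟩, hVD⟩ := (LocallyConvexSpace.convex_basis (𝕜 := ℝ) y).mem_iff.1 hD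
  exact ⟨closure V, mem_of_superset hV subset_closure, isClosed_closure, hVc.closure,
    (closure_minimal hVD hDc).trans hDN⟩

variable {f : A → E → F} {f' : A → E → E → F} {Ω : Set (A × E)}

/-- For step size `0` the segment degenerates to the single point `p`, where both conditions hold
and persist nearby by continuity. Compactness of `[0, 1]` gives one neighbourhood that works for all
`s`. -/
lemma eventually_segment_mem (hΩ : IsOpen Ω)
    (hc : ContinuousOn (fun q : (A × E) × E => f' q.1.1 q.1.2 q.2) (Ω ×ˢ univ))
    {p : A × E} (hp : p ∈ Ω) (h : E) {C : Set F} (hC : C ∈ 𝓝 (f' p.1 p.2 h)) :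
    ∀ᶠ q : ((A × E) × E) × ℝ in 𝓝 ((p, h), 0), ∀ s ∈ Icc (0 : ℝ) 1,
      (q.1.1.1, q.1.1.2 + (s * q.2) • q.1.2) ∈ Ω ∧
        f' q.1.1.1 (q.1.1.2 + (s * q.2) • q.1.2) q.1.2 ∈ C := by
  refine isCompact_Icc.eventually_forall_of_forall_eventually fun s _ => ?_
  have hcont : Continuous (fun z : (((A × E) × E) × ℝ) × ℝ =>
      (((z.1.1.1.1, z.1.1.1.2 + (z.2 * z.1.2) • z.1.1.2), z.1.1.2) : (A × E) × E)) := by fun_prop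
  have ht : Tendsto (fun z : (((A × E) × E) × ℝ) × ℝ =>
      (((z.1.1.1.1, z.1.1.1.2 + (z.2 * z.1.2) • z.1.1.2), z.1.1.2) : (A × E) × E))
      (𝓝 (((p, h), 0), s)) (𝓝 (p, h)) := by
    simpa using hcont.tendsto (((p, h), (0 : ℝ)), s)
  have hopen : (Ω ×ˢ (univ : Set E)) ∈ 𝓝 (p, h) :=
    (hΩ.prod isOpen_univ).mem_nhds ⟨hp, mem_univ _⟩
  filter_upwards [ht hopen, ht ((hc.continuousAt hopen) hC)] with z hz1 hz2
  exact ⟨hz1.1, hz2⟩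

/-- Difference quotients of a `C^1` family converge jointly in all variables. -/
lemma tendsto_slope (hΩ : IsOpen Ω)
    (hd : ∀ p ∈ Ω, ∀ h, HasDirDeriv (f p.1) p.2 h (f' p.1 p.2 h))
    (hc : ContinuousOn (fun q : (A × E) × E => f' q.1.1 q.1.2 q.2) (Ω ×ˢ univ))
    {p : A × E} (hp : p ∈ Ω) (h : E) :
    Tendsto (fun q : ((A × E) × E) × ℝ =>
      q.2⁻¹ • (f q.1.1.1 (q.1.1.2 + q.2 • q.1.2) - f q.1.1.1 q.1.1.2))
      (𝓝 ((p, h), 0) ⊓ 𝓟 {q | q.2 ≠ 0}) (𝓝 (f' p.1 p.2 h)) := by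
  intro N hN
  obtain ⟨C, hC, hCc, hCconv, hCN⟩ := exists_closed_convex_nhds hN
  rw [mem_map, mem_inf_principal]
  filter_upwards [eventually_segment_mem hΩ hc hp h hC] with q hq hq0
  exact hCN (slope_mem_of_hasDirDeriv hq0 hCc hCconv
    (fun s hs => hd _ (hq s hs).1 _) (fun s hs => (hq s hs).2))

/-- A form of `tendsto_slope` for moving base points and directions. -/
lemma tendsto_slope_comp (hΩ : IsOpen Ω)
    (hd : ∀ p ∈ Ω, ∀ h, HasDirDeriv (f p.1) p.2 h (f' p.1 p.2 h))
    (hc : ContinuousOn (fun q : (A × E) × E => f' q.1.1 q.1.2 q.2) (Ω ×ˢ univ))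
    {p : A × E} (hp : p ∈ Ω) {h : E} {a : ℝ → A} {x v : ℝ → E}
    (ha : Tendsto a (𝓝[≠] 0) (𝓝 p.1)) (hx : Tendsto x (𝓝[≠] 0) (𝓝 p.2))
    (hv : Tendsto v (𝓝[≠] 0) (𝓝 h)) :
    Tendsto (fun t : ℝ => t⁻¹ • (f (a t) (x t + t • v t) - f (a t) (x t)))
      (𝓝[≠] 0) (𝓝 (f' p.1 p.2 h)) := by
  refine (tendsto_slope hΩ hd hc hp h).comp
    (f := fun t : ℝ => (((a t, x t), v t), t)) (tendsto_inf.2 ⟨?_, ?_⟩)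
  · exact ((ha.prodMk_nhds hx).prodMk_nhds hv).prodMk_nhds (tendsto_id'.2 nhdsWithin_le_nhds)
  · exact tendsto_principal.2 eventually_mem_nhdsWithin

/-- Limits of `C^1` families with convergent derivatives. -/
lemma hasDirDeriv_of_mem_closure (hΩ : IsOpen Ω) {B : Set A}
    (hf : ContinuousOn (fun q : A × E => f q.1 q.2) Ω)
    (hd : ∀ p ∈ Ω, p.1 ∈ B → ∀ h, HasDirDeriv (f p.1) p.2 h (f' p.1 p.2 h))
    (hc : ContinuousOn (fun q : (A × E) × E => f' q.1.1 q.1.2 q.2) (Ω ×ˢ univ))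
    {p : A × E} (hp : p ∈ Ω) (hB : p.1 ∈ closure B) (h : E) :
    HasDirDeriv (f p.1) p.2 h (f' p.1 p.2 h) := by
  intro N hN
  obtain ⟨C, hC, hCc, hCconv, hCN⟩ := exists_closed_convex_nhds hN
  have hg : Tendsto (fun q : ℝ × A => (((q.2, p.2), h), q.1)) (𝓝 (0, p.1)) (𝓝 ((p, h), 0)) :=
    Continuous.tendsto' (by fun_prop) _ _ rfl
  have key := hg.eventually (eventually_segment_mem hΩ hc hp h hC)
  rw [nhds_prod_eq] at key
  rw [mem_map, mem_nhdsWithin_iff_eventually]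
  -- With `t` fixed, the quotient at `p.1` is the limit, over parameters `a ∈ B`, of quotients lying
  -- in the closed set `C`.
  filter_upwards [key.curry] with t ht ht0
  refine hCN ?_
  have hpt : (p.1, p.2 + t • h) ∈ Ω := by
    simpa using (ht.self_of_nhds 1 (by simp)).1
  have hlim : Tendsto (fun a : A => t⁻¹ • (f a (p.2 + t • h) - f a p.2)) (𝓝[B] p.1)
      (𝓝 (t⁻¹ • (f p.1 (p.2 + t • h) - f p.1 p.2))) := by
    have hcurve : ∀ x, (p.1, x) ∈ Ω → Tendsto (fun a : A => f a x) (𝓝[B] p.1) (𝓝 (f p.1 x)) := by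
      intro x hx
      have h1 : Tendsto (fun a : A => (a, x)) (𝓝[B] p.1) (𝓝 (p.1, x)) :=
        (Continuous.tendsto (by fun_prop) p.1).mono_left nhdsWithin_le_nhds
      exact (hf.continuousAt (hΩ.mem_nhds hx)).tendsto.comp h1
    exact ((hcurve _ hpt).sub (hcurve _ hp)).const_smul _
  have : (𝓝[B] p.1).NeBot := mem_closure_iff_nhdsWithin_neBot.1 hB
  refine hCc.mem_of_tendsto hlim ?_
  filter_upwards [ht.filter_mono nhdsWithin_le_nhds, self_mem_nhdsWithin] with a ha haB
  exact slope_mem_of_hasDirDeriv ht0 hCc hCconv (fun s hs => hd _ (ha s hs).1 haB _)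
    (fun s hs => (ha s hs).2)

end MeanValue

/-! ### Elementary rules for directional derivatives -/

section Linearity

variable {E : Type*} [AddCommGroup E] [Module ℝ E] [TopologicalSpace E]
  [IsTopologicalAddGroup E] [ContinuousSMul ℝ E]
  {F : Type*} [AddCommGroup F] [Module ℝ F] [TopologicalSpace F]
  [IsTopologicalAddGroup F] [ContinuousSMul ℝ F]

lemma tendsto_line (x h : E) : Tendsto (fun t : ℝ => x + t • h) (𝓝[≠] 0) (𝓝 x) :=
  (Continuous.tendsto' (by fun_prop) (0 : ℝ) x (by simp)).mono_left nhdsWithin_le_nhds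

lemma dirDeriv_congr_of_eventuallyEq {f g : E → F} {x : E} (h : E) (hfg : g =ᶠ[𝓝 x] f) :
    dirDeriv g x h = dirDeriv f x h := by
  have : (fun t : ℝ => t⁻¹ • (g (x + t • h) - g x)) =ᶠ[𝓝[≠] 0]
      fun t : ℝ => t⁻¹ • (f (x + t • h) - f x) := by
    filter_upwards [(tendsto_line x h).eventually hfg] with t ht
    rw [ht, hfg.eq_of_nhds]
  rw [dirDeriv, dirDeriv, limUnder, limUnder, map_congr this]

lemma iterDirDeriv_congr {f g : E → F} {U : Set E} (hU : IsOpen U) (hfg : EqOn g f U) :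
    ∀ (j : ℕ) {x : E} (_ : x ∈ U) (h : Fin j → E), iterDirDeriv j g x h = iterDirDeriv j f x h := by
  intro j
  induction j with
  | zero => intro x hx h; exact hfg hx
  | succ j ih =>
    intro x hx h
    exact dirDeriv_congr_of_eventuallyEq _
      (eventually_of_mem (hU.mem_nhds hx) fun z hz => ih hz _)

lemma HasDirDeriv.prodMk {G : Type*} [AddCommGroup G] [Module ℝ G] [TopologicalSpace G]
    {f : E → F} {g : E → G} {x h : E} {y : F} {z : G}
    (hf : HasDirDeriv f x h y) (hg : HasDirDeriv g x h z) :
    HasDirDeriv (fun w => (f w, g w)) x h (y, z) :=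
  Tendsto.prodMk_nhds hf hg

lemma HasDirDeriv.smul_dir {f : E → F} {x h : E} {y : F} (hf : HasDirDeriv f x h y) (c : ℝ) :
    HasDirDeriv f x (c • h) (c • y) := by
  rcases eq_or_ne c 0 with rfl | hc
  · simp only [HasDirDeriv, zero_smul, smul_zero, add_zero, sub_self]
    exact tendsto_const_nhds
  · have h1 : Tendsto (fun t : ℝ => t * c) (𝓝[≠] 0) (𝓝[≠] 0) := by
      refine tendsto_nhdsWithin_iff.2 ⟨?_, ?_⟩
      · exact (Continuous.tendsto' (by fun_prop) (0 : ℝ) 0 (by simp)).mono_left nhdsWithin_le_nhds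
      · filter_upwards [self_mem_nhdsWithin] with t ht
        exact mul_ne_zero ht hc
    refine ((hf.comp h1).const_smul c).congr fun t => ?_
    simp only [Function.comp_apply, smul_smul, mul_inv, mul_comm t⁻¹, ← mul_assoc,
      mul_inv_cancel₀ hc, one_mul]

lemma hasDirDeriv_const (c : F) (x h : E) : HasDirDeriv (fun _ : E => c) x h 0 := by
  simp only [HasDirDeriv, sub_self, smul_zero]
  exact tendsto_const_nhds

lemma ContinuousLinearMap.hasDirDeriv (T : E →L[ℝ] F) (x h : E) : HasDirDeriv T x h (T h) := by
  refine tendsto_const_nhds.congr' ?_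
  filter_upwards [self_mem_nhdsWithin] with t ht
  rw [map_add, add_sub_cancel_left, map_smul, smul_smul, inv_mul_cancel₀ ht, one_smul]

end Linearity

/-! ### Multilinearity of iterated directional derivatives -/

section Multilinear

variable {E : Type*} [AddCommGroup E] [Module ℝ E] [TopologicalSpace E]
  [IsTopologicalAddGroup E] [ContinuousSMul ℝ E]
  {F : Type*} [AddCommGroup F] [Module ℝ F] [TopologicalSpace F]
  [IsTopologicalAddGroup F] [ContinuousSMul ℝ F] [LocallyConvexSpace ℝ F] [T2Space F]

/-- A step along `u + v` is a step along `u` followed by one along `v` from the moved base point `x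
+ t • u`. By `tendsto_slope_comp` the second quotient still tends to `g' x v`. -/
lemma dirDeriv_add_dir {g : E → F} {g' : E → E → F} {U : Set E} (hU : IsOpen U)
    (hd : ∀ x ∈ U, ∀ h, HasDirDeriv g x h (g' x h))
    (hc : ContinuousOn (fun q : E × E => g' q.1 q.2) (U ×ˢ univ))
    {x : E} (hx : x ∈ U) (u v : E) : g' x (u + v) = g' x u + g' x v := by
  have h1 : Tendsto (fun t : ℝ => t⁻¹ • (g ((x + t • u) + t • v) - g (x + t • u)))
      (𝓝[≠] 0) (𝓝 (g' x v)) :=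
    tendsto_slope_comp (A := Unit) (f := fun _ => g) (f' := fun _ => g')
      (Ω := {p | p.2 ∈ U}) (p := ((), x)) (a := fun _ => ()) (x := fun t : ℝ => x + t • u)
      (v := fun _ => v) (hU.preimage continuous_snd) (fun p hp => hd p.2 hp)
      (hc.comp (f := fun q : (Unit × E) × E => (q.1.2, q.2)) (by fun_prop)
        fun q hq => ⟨hq.1, mem_univ _⟩) hx
      tendsto_const_nhds (tendsto_line x u) tendsto_const_nhds
  refine tendsto_nhds_unique (hd x hx (u + v)) ((Tendsto.add (hd x hx u) h1).congr fun t => ?_)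
  rw [← smul_add, smul_add t, ← add_assoc]
  congr 1
  abel

variable {k : ℕ∞} {f : E → F} {U : Set E}

lemma lt_of_succ_le {j : ℕ} (hj : ((j + 1 : ℕ) : ℕ∞) ≤ k) : (j : ℕ∞) < k :=
  lt_of_lt_of_le (by exact_mod_cast Nat.lt_succ_self j) hj

lemma IsCkOn.hasDirDeriv_snoc (hf : IsCkOn k f U) {j : ℕ} (hj : (j : ℕ∞) < k) {x : E}
    (hx : x ∈ U) (h : Fin j → E) (v : E) :
    HasDirDeriv (fun z => iterDirDeriv j f z h) x v
      (iterDirDeriv (j + 1) f x (Fin.snoc h v : Fin (j + 1) → E)) := by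
  simpa using hf.hasDirDeriv hj hx (Fin.snoc h v : Fin (j + 1) → E)

lemma IsCkOn.iterDirDeriv_snoc_add (hU : IsOpen U) (hf : IsCkOn k f U) {j : ℕ}
    (hj : (j : ℕ∞) < k) {x : E} (hx : x ∈ U) (h : Fin j → E) (u v : E) :
    iterDirDeriv (j + 1) f x (Fin.snoc h (u + v) : Fin (j + 1) → E) =
      iterDirDeriv (j + 1) f x (Fin.snoc h u : Fin (j + 1) → E) +
      iterDirDeriv (j + 1) f x (Fin.snoc h v : Fin (j + 1) → E) :=
  dirDeriv_add_dir (g' := fun x v => iterDirDeriv (j + 1) f x (Fin.snoc h v : Fin (j + 1) → E)) hU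
    (fun x hx v => hf.hasDirDeriv_snoc hj hx h v)
    ((hf.continuousOn (j + 1) (by exact_mod_cast Order.add_one_le_of_lt hj)).comp
      (f := fun q : E × E => (q.1, (Fin.snoc h q.2 : Fin (j + 1) → E)))
      (Continuous.continuousOn (by fun_prop)) fun q hq => ⟨hq.1, mem_univ _⟩) hx u v

/-- The last slot is additive by `dirDeriv_add_dir`. Additivity in an earlier slot holds for the
order below on all of the open set `U`, and is then differentiated along the last direction;
symmetry of higher derivatives plays no role. -/
lemma IsCkOn.iterDirDeriv_update_add (hU : IsOpen U) (hf : IsCkOn k f U) : ∀ j : ℕ,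
    (j : ℕ∞) ≤ k → ∀ x ∈ U, ∀ (h : Fin j → E) (i : Fin j) (u v : E),
    iterDirDeriv j f x (Function.update h i (u + v)) =
      iterDirDeriv j f x (Function.update h i u) + iterDirDeriv j f x (Function.update h i v) := by
  intro j
  induction j with
  | zero => intro _ _ _ _ i; exact i.elim0
  | succ j ih =>
    intro hj x hx h i u v
    have hj' := lt_of_succ_le hj
    obtain ⟨h, w, rfl⟩ : ∃ h' w, h = (Fin.snoc h' w : Fin (j + 1) → E) :=
      ⟨_, _, (Fin.snoc_init_self h).symm⟩
    refine Fin.lastCases ?_ (fun i => ?_) i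
    · simp only [Fin.update_snoc_last]
      exact hf.iterDirDeriv_snoc_add hU hj' hx h u v
    · simp only [← Fin.snoc_update]
      exact (((hf.hasDirDeriv_snoc hj' hx _ w).add
        (hf.hasDirDeriv_snoc hj' hx _ w)).congr_of_eqOn hU hx
        (fun z hz => ih hj'.le z hz h i u v)).dirDeriv_eq.symm.trans
          (hf.hasDirDeriv_snoc hj' hx _ w).dirDeriv_eq |>.symm

lemma IsCkOn.iterDirDeriv_update_smul (hU : IsOpen U) (hf : IsCkOn k f U) : ∀ j : ℕ,
    (j : ℕ∞) ≤ k → ∀ x ∈ U, ∀ (h : Fin j → E) (i : Fin j) (c : ℝ) (u : E),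
    iterDirDeriv j f x (Function.update h i (c • u)) =
      c • iterDirDeriv j f x (Function.update h i u) := by
  intro j
  induction j with
  | zero => intro _ _ _ _ i; exact i.elim0
  | succ j ih =>
    intro hj x hx h i c u
    have hj' := lt_of_succ_le hj
    obtain ⟨h, w, rfl⟩ : ∃ h' w, h = (Fin.snoc h' w : Fin (j + 1) → E) :=
      ⟨_, _, (Fin.snoc_init_self h).symm⟩
    refine Fin.lastCases ?_ (fun i => ?_) i
    · simp only [Fin.update_snoc_last]
      exact (hf.hasDirDeriv_snoc hj' hx h (c • u)).dirDeriv_eq.symm.trans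
        ((hf.hasDirDeriv_snoc hj' hx h u).smul_dir c).dirDeriv_eq
    · simp only [← Fin.snoc_update]
      exact ((hf.hasDirDeriv_snoc hj' hx _ w).dirDeriv_eq).symm.trans
        (((hf.hasDirDeriv_snoc hj' hx _ w).const_smul c).congr_of_eqOn hU hx
          (fun z hz => ih hj'.le z hz h i c u)).dirDeriv_eq

/-- The total derivative of `(x, h) ↦ d^j f (x) (h)`. -/
lemma IsCkOn.tendsto_slope_iterDirDeriv (hU : IsOpen U) (hf : IsCkOn k f U) {j : ℕ}
    (hj : (j : ℕ∞) < k) {x : E} (hx : x ∈ U) (v : E) (h w : Fin j → E) :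
    Tendsto (fun t : ℝ => t⁻¹ • (iterDirDeriv j f (x + t • v) (h + t • w) - iterDirDeriv j f x h))
      (𝓝[≠] 0) (𝓝 (iterDirDeriv (j + 1) f x (Fin.snoc h v : Fin (j + 1) → E) +
        ∑ i, iterDirDeriv j f x (Function.update h i (w i)))) := by
  classical
  have hmem : ∀ᶠ t : ℝ in 𝓝[≠] 0, x + t • v ∈ U := (tendsto_line x v).eventually (hU.mem_nhds hx)
  -- The increments `t • w i` are switched on one slot at a time. By multilinearity each new slot
  -- contributes, after division by `t`, the derivative with `w i` in that slot, which converges by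
  -- continuity.
  have key : ∀ s : Finset (Fin j), Tendsto (fun t : ℝ => t⁻¹ •
      (iterDirDeriv j f (x + t • v) (h + t • s.piecewise w 0) - iterDirDeriv j f (x + t • v) h))
      (𝓝[≠] 0) (𝓝 (∑ i ∈ s, iterDirDeriv j f x (Function.update h i (w i)))) := by
    intro s
    induction s using Finset.induction_on with
    | empty => simp
    | insert i s hi ih =>
      rw [Finset.sum_insert hi]
      have h1 : Tendsto (fun t : ℝ => (x + t • v, Function.update (h + t • s.piecewise w 0) i (w i)))
          (𝓝[≠] 0) (𝓝 (x, Function.update h i (w i))) :=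
        (Continuous.tendsto' (by fun_prop) (0 : ℝ) _ (by simp)).mono_left nhdsWithin_le_nhds
      have h2 := ((hf.continuousOn j hj.le).continuousAt
        ((hU.prod isOpen_univ).mem_nhds ⟨hx, mem_univ (Function.update h i (w i))⟩)).tendsto.comp h1
      refine (h2.add ih).congr' ?_
      filter_upwards [hmem, self_mem_nhdsWithin] with t ht ht0
      have e1 : h + t • (insert i s).piecewise w 0 =
          Function.update (h + t • s.piecewise w 0) i (h i + t • w i) := by
        ext l
        rcases eq_or_ne l i with rfl | hl
        · simp
        · simp [hl, Finset.piecewise_insert_of_ne]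
      have e2 : Function.update (h + t • s.piecewise w 0) i (h i) = h + t • s.piecewise w 0 := by
        rw [Function.update_eq_self_iff]
        simp [hi]
      rw [e1, hf.iterDirDeriv_update_add hU j hj.le _ ht, e2,
        hf.iterDirDeriv_update_smul hU j hj.le _ ht, add_sub_right_comm, add_comm, smul_add,
        smul_smul, inv_mul_cancel₀ ht0, one_smul, add_comm]
      rw [add_comm]
      rfl
  refine (Tendsto.add (hf.hasDirDeriv_snoc hj hx h v) (key Finset.univ)).congr fun t => ?_
  rw [← smul_add, Finset.piecewise_univ]
  congr 1
  abel

end Multilinear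

/-! ### Continuous families of `C^k` maps -/

section Families

universe u
variable {A : Type*} [TopologicalSpace A]

/-- `f : A → E → F` is a family of `C^k` maps on the slices of `Ω ⊆ A × E`, whose derivatives of
order `≤ k` are jointly continuous in the parameter and the variables. -/
structure IsCkFamilyOn {E F : Type*} [AddCommGroup E] [Module ℝ E] [TopologicalSpace E]
    [AddCommGroup F] [Module ℝ F] [TopologicalSpace F]
    (k : ℕ∞) (f : A → E → F) (Ω : Set (A × E)) : Prop where
  exists_deriv : ∀ j : ℕ, (j : ℕ∞) < k → ∀ p ∈ Ω, ∀ h : Fin (j + 1) → E,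
    ∃ y : F, HasDirDeriv (fun z => iterDirDeriv j (f p.1) z (Fin.init h)) p.2 (h (Fin.last j)) y
  continuousOn : ∀ j : ℕ, (j : ℕ∞) ≤ k → ContinuousOn
    (fun q : (A × E) × (Fin j → E) => iterDirDeriv j (f q.1.1) q.1.2 q.2) (Ω ×ˢ univ)

variable {E : Type*} [AddCommGroup E] [Module ℝ E] [TopologicalSpace E]
  [IsTopologicalAddGroup E] [ContinuousSMul ℝ E]
  {Z : Type*} [AddCommGroup Z] [Module ℝ Z] [TopologicalSpace Z]
  [IsTopologicalAddGroup Z] [ContinuousSMul ℝ Z]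
  {F : Type*} [AddCommGroup F] [Module ℝ F] [TopologicalSpace F]
  [IsTopologicalAddGroup F] [ContinuousSMul ℝ F] [LocallyConvexSpace ℝ F] [T2Space F]
  {G : Type*} [AddCommGroup G] [Module ℝ G] [TopologicalSpace G]
  [IsTopologicalAddGroup G] [ContinuousSMul ℝ G] [LocallyConvexSpace ℝ G] [T2Space G]
  {k : ℕ∞} {f g : A → E → F} {Ω : Set (A × E)}

lemma isOpen_slice (hΩ : IsOpen Ω) (a : A) : IsOpen {x | (a, x) ∈ Ω} :=
  hΩ.preimage (by fun_prop)

lemma IsCkFamilyOn.slice (hf : IsCkFamilyOn k f Ω) (a : A) : IsCkOn k (f a) {x | (a, x) ∈ Ω} where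
  exists_deriv j hj x hx h := hf.exists_deriv j hj (a, x) hx h
  continuousOn j hj := (hf.continuousOn j hj).comp
    (f := fun q : E × (Fin j → E) => ((a, q.1), q.2)) (by fun_prop) fun _ hq => ⟨hq.1, mem_univ _⟩

lemma IsCkOn.family {f : E → F} {U : Set E} (hf : IsCkOn k f U) :
    IsCkFamilyOn k (fun _ : A => f) {p | p.2 ∈ U} where
  exists_deriv j hj p hp h := hf.exists_deriv j hj p.2 hp h
  continuousOn j hj := (hf.continuousOn j hj).comp
    (f := fun q : (A × E) × (Fin j → E) => (q.1.2, q.2)) (by fun_prop)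
    fun _ hq => ⟨hq.1, mem_univ _⟩

lemma IsCkFamilyOn.mono {Ω' : Set (A × E)} (hf : IsCkFamilyOn k f Ω) (h : Ω' ⊆ Ω) :
    IsCkFamilyOn k f Ω' where
  exists_deriv j hj p hp := hf.exists_deriv j hj p (h hp)
  continuousOn j hj := (hf.continuousOn j hj).mono (prod_mono h subset_rfl)

lemma IsCkOn.mono {f : E → F} {U V : Set E} (hf : IsCkOn k f U) (h : V ⊆ U) : IsCkOn k f V where
  exists_deriv j hj p hp := hf.exists_deriv j hj p (h hp)
  continuousOn j hj := (hf.continuousOn j hj).mono (prod_mono h subset_rfl)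

lemma IsCkFamilyOn.of_le {l : ℕ∞} (hf : IsCkFamilyOn k f Ω) (h : l ≤ k) : IsCkFamilyOn l f Ω where
  exists_deriv j hj := hf.exists_deriv j (hj.trans_le h)
  continuousOn j hj := hf.continuousOn j (hj.trans h)

/-- Reduces `k = ∞` to finite orders, so that closure properties can be proved by induction. -/
lemma isCkFamilyOn_of_nat (h : ∀ n : ℕ, (n : ℕ∞) ≤ k → IsCkFamilyOn n f Ω) :
    IsCkFamilyOn k f Ω where
  exists_deriv j hj := (h (j + 1) (by exact_mod_cast Order.add_one_le_of_lt hj)).exists_deriv j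
    (by exact_mod_cast Nat.lt_succ_self j)
  continuousOn j hj := (h j hj).continuousOn j le_rfl

lemma IsCkFamilyOn.congr (hΩ : IsOpen Ω) (hf : IsCkFamilyOn k f Ω)
    (hfg : ∀ p ∈ Ω, g p.1 p.2 = f p.1 p.2) : IsCkFamilyOn k g Ω where
  exists_deriv j hj p hp h := by
    obtain ⟨y, hy⟩ := hf.exists_deriv j hj p hp h
    exact ⟨y, hy.congr_of_eqOn (isOpen_slice hΩ p.1) hp fun z hz =>
      iterDirDeriv_congr (isOpen_slice hΩ p.1) (fun x hx => hfg (p.1, x) hx) j hz _⟩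
  continuousOn j hj := (hf.continuousOn j hj).congr fun q hq =>
      iterDirDeriv_congr (isOpen_slice hΩ q.1.1) (fun x hx => hfg (q.1.1, x) hx) j hq.1 _

lemma isCkFamilyOn_of_local (hf : ∀ p ∈ Ω, ∃ Ω', IsOpen Ω' ∧ p ∈ Ω' ∧ IsCkFamilyOn k f Ω') :
    IsCkFamilyOn k f Ω where
  exists_deriv j hj p hp h := by
    obtain ⟨Ω', _, hp', hf'⟩ := hf p hp
    exact hf'.exists_deriv j hj p hp' h
  continuousOn j hj q hq := by
    obtain ⟨Ω', ho, hp', hf'⟩ := hf q.1 hq.1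
    exact ((hf'.continuousOn j hj).continuousAt
      ((ho.prod isOpen_univ).mem_nhds ⟨hp', mem_univ _⟩)).continuousWithinAt

lemma IsCkFamilyOn.continuousOn_zero (hf : IsCkFamilyOn k f Ω) :
    ContinuousOn (fun p : A × E => f p.1 p.2) Ω :=
  (hf.continuousOn 0 (by simp)).comp (f := fun p : A × E => (p, (Fin.elim0 : Fin 0 → E)))
    (by fun_prop) fun _ hp => ⟨hp, mem_univ _⟩

lemma isCkFamilyOn_zero_iff : IsCkFamilyOn 0 f Ω ↔ ContinuousOn (fun p : A × E => f p.1 p.2) Ω := by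
  refine ⟨fun h => h.continuousOn_zero, fun h => ⟨fun j hj => by simp at hj, fun j hj => ?_⟩⟩
  obtain rfl : j = 0 := by simpa using hj
  exact h.comp (f := fun q : (A × E) × (Fin 0 → E) => q.1) (by fun_prop) fun _ hq => hq.1

lemma isOpen_tangent (hΩ : IsOpen Ω) : IsOpen {q : A × E × E | (q.1, q.2.1) ∈ Ω} :=
  hΩ.preimage (by fun_prop)

lemma dirDeriv_prod_left (g : E × Z → F) (x h : E) (z : Z) :
    dirDeriv (fun x => g (x, z)) x h = dirDeriv g (x, z) (h, 0) := by
  simp [dirDeriv]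

lemma hasDirDeriv_prod_left {g : E × Z → F} {x h : E} {z : Z} {y : F} :
    HasDirDeriv (fun x => g (x, z)) x h y ↔ HasDirDeriv g (x, z) (h, 0) y := by
  simp [HasDirDeriv]

/-- The first direction is absorbed into the base point `(x, h 0)`; later directions move only `x`,
hence their zero second components. Orders can thus be lowered by one at the price of replacing `E`
by `E × E`. -/
lemma iterDirDeriv_succ_eq {f : E → F} {f' : E × E → F} {U : Set E} (hU : IsOpen U)
    (hd : ∀ x ∈ U, ∀ h, HasDirDeriv f x h (f' (x, h))) : ∀ (j : ℕ), ∀ x ∈ U, ∀ h : Fin (j + 1) → E,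
    iterDirDeriv (j + 1) f x h = iterDirDeriv j f' (x, h 0) (fun i => (h i.succ, 0)) := by
  intro j
  induction j with
  | zero => exact fun x hx h => (hd x hx _).dirDeriv_eq
  | succ j ih =>
    intro x hx h
    exact (dirDeriv_congr_of_eventuallyEq _
      (eventually_of_mem (hU.mem_nhds hx) fun z hz => ih z hz _)).trans
      (dirDeriv_prod_left (fun w => iterDirDeriv j f' w _) x (h (Fin.last _)) (h 0))

/-- A criterion for `C^{k+1}` in terms of the first derivative. -/
lemma isCkFamilyOn_succ (hΩ : IsOpen Ω) {f' : A → E × E → F} {n : ℕ}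
    (hc : ContinuousOn (fun p : A × E => f p.1 p.2) Ω)
    (hd : ∀ p ∈ Ω, ∀ h, HasDirDeriv (f p.1) p.2 h (f' p.1 (p.2, h)))
    (hf' : IsCkFamilyOn n f' {q : A × E × E | (q.1, q.2.1) ∈ Ω}) :
    IsCkFamilyOn ((n + 1 : ℕ) : ℕ∞) f Ω := by
  have key : ∀ (j : ℕ), ∀ p ∈ Ω, ∀ h : Fin (j + 1) → E, iterDirDeriv (j + 1) (f p.1) p.2 h =
      iterDirDeriv j (f' p.1) (p.2, h 0) (fun i => (h i.succ, 0)) := fun j p hp h =>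
    iterDirDeriv_succ_eq (isOpen_slice hΩ p.1) (fun x hx h => hd (p.1, x) hx h) j p.2 hp h
  refine ⟨fun j hj p hp h => ?_, fun j hj => ?_⟩
  · cases j with
    | zero => exact ⟨_, hd p hp _⟩
    | succ j =>
      obtain ⟨y, hy⟩ := hf'.exists_deriv j (by simpa using hj) (p.1, p.2, h 0) hp
        (fun i => (h i.succ, 0))
      exact ⟨y, (hasDirDeriv_prod_left.2 hy).congr_of_eqOn (isOpen_slice hΩ p.1) hp
        fun z hz => key j (p.1, z) hz _⟩
  · cases j with
    | zero => exact (isCkFamilyOn_zero_iff.2 hc).continuousOn 0 (by simp)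
    | succ j =>
      refine ((hf'.continuousOn j (by simpa using hj)).comp
        (f := fun q : (A × E) × (Fin (j + 1) → E) => ((q.1.1, q.1.2, q.2 0),
          fun i : Fin j => ((q.2 i.succ, 0) : E × E))) (by fun_prop)
        fun q hq => ⟨hq.1, mem_univ _⟩).congr fun q hq => key j q.1 hq.1 q.2

lemma IsCkFamilyOn.hasDirDeriv (hf : IsCkFamilyOn k f Ω) (hk : 1 ≤ k) {p : A × E} (hp : p ∈ Ω)
    (h : E) : HasDirDeriv (f p.1) p.2 h (dirDeriv (f p.1) p.2 h) :=
  (hf.slice p.1).hasDirDeriv (j := 0) (lt_of_lt_of_le (by simp) hk) hp (fun _ => h)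

lemma IsCkFamilyOn.continuousOn_dirDeriv (hf : IsCkFamilyOn k f Ω) (hk : 1 ≤ k) :
    ContinuousOn (fun q : (A × E) × E => dirDeriv (f q.1.1) q.1.2 q.2) (Ω ×ˢ univ) :=
  (hf.continuousOn 1 (by exact_mod_cast hk)).comp
    (f := fun q : (A × E) × E => (q.1, fun _ : Fin 1 => q.2)) (by fun_prop)
    fun _ hq => ⟨hq.1, mem_univ _⟩

lemma IsCkFamilyOn.add (hΩ : IsOpen Ω) (hf : IsCkFamilyOn k f Ω) (hg : IsCkFamilyOn k g Ω) :
    IsCkFamilyOn k (fun a x => f a x + g a x) Ω where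
  exists_deriv j hj p hp h :=
    ((hf.slice p.1).add (isOpen_slice hΩ p.1) (hg.slice p.1)).exists_deriv j hj p.2 hp h
  continuousOn j hj := ((hf.continuousOn j hj).add (hg.continuousOn j hj)).congr fun q hq =>
    (hf.slice q.1.1).iterDirDeriv_add (isOpen_slice hΩ q.1.1) (hg.slice q.1.1) j hj q.1.2 hq.1 q.2

lemma IsCkFamilyOn.sum {ι : Type*} (s : Finset ι) {f : ι → A → E → F} (hΩ : IsOpen Ω)
    (hf : ∀ i ∈ s, IsCkFamilyOn k (f i) Ω) :
    IsCkFamilyOn k (fun a x => ∑ i ∈ s, f i a x) Ω := by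
  classical
  induction s using Finset.induction_on with
  | empty =>
    simp only [Finset.sum_empty]
    exact (isCkOn_zero (U := univ)).family.mono fun _ _ => mem_univ _
  | insert i s hi ih =>
    simp only [Finset.sum_insert hi]
    exact (hf i (by simp)).add hΩ (ih fun l hl => hf l (by simp [hl]))

/-- The iterated derivatives of a `C^n` family, as functions of all variables. -/
lemma IsCkFamilyOn.iterDirDeriv_comp_linear (hΩ : IsOpen Ω) (hf : IsCkFamilyOn k f Ω) (n : ℕ) :
    ∀ {Z : Type u} [AddCommGroup Z] [Module ℝ Z] [TopologicalSpace Z]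
    [IsTopologicalAddGroup Z] [ContinuousSMul ℝ Z] (j : ℕ) (_ : ((j + n : ℕ) : ℕ∞) ≤ k)
    (α : Z →L[ℝ] E) (L : Z →L[ℝ] (Fin j → E)),
    IsCkFamilyOn n (fun a z => iterDirDeriv j (f a) (α z) (L z)) {p | (p.1, α p.2) ∈ Ω} := by
  have hopen : ∀ {Z : Type u} [AddCommGroup Z] [Module ℝ Z] [TopologicalSpace Z] (α : Z →L[ℝ] E),
    IsOpen {p : A × Z | (p.1, α p.2) ∈ Ω} := fun α => hΩ.preimage (by fun_prop)
  have hcont : ∀ {Z : Type u} [AddCommGroup Z] [Module ℝ Z] [TopologicalSpace Z]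
      (j : ℕ) (_ : (j : ℕ∞) ≤ k) (α : Z →L[ℝ] E) (L : Z →L[ℝ] (Fin j → E)), ContinuousOn
      (fun p : A × Z => iterDirDeriv j (f p.1) (α p.2) (L p.2)) {p | (p.1, α p.2) ∈ Ω} :=
    fun j hj α L => (hf.continuousOn j hj).comp
      (f := fun p : A × _ => ((p.1, α p.2), L p.2)) (by fun_prop) fun _ hp => ⟨hp, mem_univ _⟩
  induction n with
  | zero =>
    intro Z _ _ _ _ _ j hj α L
    exact_mod_cast isCkFamilyOn_zero_iff.2 (hcont j hj α L)
  | succ n ih =>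
    intro Z _ _ _ _ _ j hj α L
    have hj' : (j : ℕ∞) < k :=
      lt_of_lt_of_le (by exact_mod_cast Nat.lt_add_of_pos_right (Nat.succ_pos n)) hj
    let fstZ := ContinuousLinearMap.fst ℝ Z Z
    let sndZ := ContinuousLinearMap.snd ℝ Z Z
    -- Product rule for `z ↦ d^j f (α z) (L z)`: varying the base point raises the order and appends
    -- `α w` (`L₁`), varying the `i`-th direction replaces it by `L w i` (`L₂ i`). Both terms have
    -- the original form over `Z × Z`, so the induction closes.
    let L₁ : Z × Z →L[ℝ] (Fin (j + 1) → E) := ContinuousLinearMap.pi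
      (Fin.snoc (fun i => (ContinuousLinearMap.proj i).comp (L.comp fstZ)) (α.comp sndZ) :
        Fin (j + 1) → (Z × Z →L[ℝ] E))
    let L₂ : Fin j → (Z × Z →L[ℝ] (Fin j → E)) := fun i => ContinuousLinearMap.pi
      (Function.update (fun l => (ContinuousLinearMap.proj l).comp (L.comp fstZ)) i
        ((ContinuousLinearMap.proj i).comp (L.comp sndZ)))
    have hL₁ : ∀ z w, L₁ (z, w) = (Fin.snoc (L z) (α w) : Fin (j + 1) → E) := by
      intro z w
      ext l
      refine Fin.lastCases ?_ (fun l => ?_) l <;> simp [L₁, fstZ, sndZ]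
    have hL₂ : ∀ i z w, L₂ i (z, w) = Function.update (L z) i (L w i) := by
      intro i z w
      ext l
      rcases eq_or_ne l i with rfl | hl
      · simp [L₂, sndZ]
      · simp [L₂, fstZ, hl]
    refine isCkFamilyOn_succ (f' := fun a q => iterDirDeriv (j + 1) (f a) ((α.comp fstZ) q) (L₁ q) +
      ∑ i, iterDirDeriv j (f a) ((α.comp fstZ) q) (L₂ i q)) (hopen α) (hcont j hj'.le α L) ?_ ?_
    · intro p hp h
      have := (hf.slice p.1).tendsto_slope_iterDirDeriv (isOpen_slice hΩ p.1) hj' hp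
        (α h) (L p.2) (L h)
      simp only [HasDirDeriv, hL₁, hL₂]
      simpa [fstZ] using this
    · refine IsCkFamilyOn.add (hopen (α.comp fstZ)) (ih (j + 1) ?_ (α.comp fstZ) L₁)
        (IsCkFamilyOn.sum _ (hopen (α.comp fstZ))
          fun i _ => ih j (le_trans ?_ hj) (α.comp fstZ) (L₂ i))
      · rwa [Nat.add_right_comm]
      · exact_mod_cast Nat.le_succ _

/-- The case `j = 0` of the preceding lemma. The chain rule below already relies on it, for the
projection `E × E → E`. -/
lemma IsCkFamilyOn.comp_linear (hΩ : IsOpen Ω) (hf : IsCkFamilyOn k f Ω) (α : Z →L[ℝ] E) :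
    IsCkFamilyOn k (fun a z => f a (α z)) {p | (p.1, α p.2) ∈ Ω} :=
  isCkFamilyOn_of_nat fun n hn => hf.iterDirDeriv_comp_linear hΩ n 0 (by simpa using hn) α 0

/-- The first derivative of a `C^{n+1}` family is a `C^n` family. -/
lemma IsCkFamilyOn.dirDeriv {n : ℕ} (hΩ : IsOpen Ω) (hf : IsCkFamilyOn ((n + 1 : ℕ) : ℕ∞) f Ω) :
    IsCkFamilyOn n (fun a (q : E × E) => dirDeriv (f a) q.1 q.2)
      {q : A × E × E | (q.1, q.2.1) ∈ Ω} :=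
  hf.iterDirDeriv_comp_linear hΩ n 1 (by rw [add_comm]) (ContinuousLinearMap.fst ℝ E E)
    (ContinuousLinearMap.pi fun _ => ContinuousLinearMap.snd ℝ E E)

lemma IsCkFamilyOn.prodMk {f : A → E → F} {g : A → E → G} (hΩ : IsOpen Ω)
    (hf : IsCkFamilyOn k f Ω) (hg : IsCkFamilyOn k g Ω) :
    IsCkFamilyOn k (fun a x => (f a x, g a x)) Ω := by
  -- The source space is quantified inside the induction because the derivative is a family on `E ×
  -- E`.
  have key : ∀ n : ℕ, ∀ {E : Type _} [AddCommGroup E] [Module ℝ E] [TopologicalSpace E]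
      [IsTopologicalAddGroup E] [ContinuousSMul ℝ E] {f : A → E → F} {g : A → E → G}
      {Ω : Set (A × E)} (_ : IsOpen Ω) (_ : IsCkFamilyOn n f Ω) (_ : IsCkFamilyOn n g Ω),
      IsCkFamilyOn n (fun a x => (f a x, g a x)) Ω := by
    intro n
    induction n with
    | zero =>
      intro E _ _ _ _ _ f g Ω hΩ hf hg
      exact_mod_cast isCkFamilyOn_zero_iff.2 (hf.continuousOn_zero.prodMk hg.continuousOn_zero)
    | succ n ih =>
      intro E _ _ _ _ _ f g Ω hΩ hf hg
      have h1 : (1 : ℕ∞) ≤ ((n + 1 : ℕ) : ℕ∞) := by exact_mod_cast Nat.le_add_left 1 n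
      exact isCkFamilyOn_succ hΩ (hf.continuousOn_zero.prodMk hg.continuousOn_zero)
        (fun p hp h => (hf.hasDirDeriv h1 hp h).prodMk (hg.hasDirDeriv h1 hp h))
        (ih (isOpen_tangent hΩ) (hf.dirDeriv hΩ) (hg.dirDeriv hΩ))
  exact isCkFamilyOn_of_nat fun n hn => key n hΩ (hf.of_le hn) (hg.of_le hn)

/-- The chain rule for families. -/
lemma IsCkFamilyOn.comp {f : A → E → F} {g : A → F → G} {Ω' : Set (A × F)} (hΩ : IsOpen Ω)
    (hΩ' : IsOpen Ω') (hg : IsCkFamilyOn k g Ω') (hf : IsCkFamilyOn k f Ω)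
    (hmap : ∀ p ∈ Ω, (p.1, f p.1 p.2) ∈ Ω') : IsCkFamilyOn k (fun a x => g a (f a x)) Ω := by
  have key : ∀ n : ℕ, ∀ {E : Type _} [AddCommGroup E] [Module ℝ E] [TopologicalSpace E]
      [IsTopologicalAddGroup E] [ContinuousSMul ℝ E]
      {F : Type _} [AddCommGroup F] [Module ℝ F] [TopologicalSpace F]
      [IsTopologicalAddGroup F] [ContinuousSMul ℝ F] [LocallyConvexSpace ℝ F] [T2Space F]
      {f : A → E → F} {g : A → F → G} {Ω : Set (A × E)} {Ω' : Set (A × F)} (_ : IsOpen Ω)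
      (_ : IsOpen Ω') (_ : IsCkFamilyOn n g Ω') (_ : IsCkFamilyOn n f Ω)
      (_ : ∀ p ∈ Ω, (p.1, f p.1 p.2) ∈ Ω'), IsCkFamilyOn n (fun a x => g a (f a x)) Ω := by
    intro n
    induction n with
    | zero =>
      intro E _ _ _ _ _ F _ _ _ _ _ _ _ f g Ω Ω' hΩ hΩ' hg hf hmap
      exact_mod_cast isCkFamilyOn_zero_iff.2 (hg.continuousOn_zero.comp
        (f := fun p : A × E => (p.1, f p.1 p.2))
        (continuousOn_fst.prodMk hf.continuousOn_zero) hmap)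
    | succ n ih =>
      intro E _ _ _ _ _ F _ _ _ _ _ _ _ f g Ω Ω' hΩ hΩ' hg hf hmap
      have h1 : (1 : ℕ∞) ≤ ((n + 1 : ℕ) : ℕ∞) := by exact_mod_cast Nat.le_add_left 1 n
      refine isCkFamilyOn_succ hΩ (hg.continuousOn_zero.comp
        (f := fun p : A × E => (p.1, f p.1 p.2))
        (continuousOn_fst.prodMk hf.continuousOn_zero) hmap) (fun p hp h => ?_)
        (ih (isOpen_tangent hΩ) (isOpen_tangent hΩ') (hg.dirDeriv hΩ')
          (IsCkFamilyOn.prodMk (isOpen_tangent hΩ)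
            ((hf.of_le (by exact_mod_cast Nat.le_succ n)).comp_linear hΩ
              (ContinuousLinearMap.fst ℝ E E)) (hf.dirDeriv hΩ))
          fun q hq => hmap (q.1, q.2.1) hq)
      -- Here `f (x + t h) = f x + t v(t)` with `v(t)` the difference quotient of `f`, so the
      -- quotient of the composite is a quotient of `g` in the moving direction `v(t) → df x h`.
      have hlim := tendsto_slope_comp (f' := fun a x h => _root_.dirDeriv (g a) x h) hΩ'
        (fun p hp h => hg.hasDirDeriv h1 hp h)
        (hg.continuousOn_dirDeriv h1) (hmap p hp) (a := fun _ => p.1) (x := fun _ => f p.1 p.2)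
        tendsto_const_nhds tendsto_const_nhds (hf.hasDirDeriv h1 hp h)
      refine hlim.congr' ?_
      filter_upwards [self_mem_nhdsWithin] with t ht
      rw [smul_smul, mul_inv_cancel₀ ht, one_smul, add_sub_cancel]
  exact isCkFamilyOn_of_nat fun n hn => key n hΩ hΩ' (hg.of_le hn) (hf.of_le hn) hmap

lemma isCkFamilyOn_linear (T : E →L[ℝ] F) (Ω : Set (A × E)) :
    IsCkFamilyOn k (fun _ => T) Ω := by
  have key : ∀ n : ℕ, ∀ {E : Type _} [AddCommGroup E] [Module ℝ E] [TopologicalSpace E]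
      [IsTopologicalAddGroup E] [ContinuousSMul ℝ E] (T : E →L[ℝ] F),
      IsCkFamilyOn n (fun _ : A => T) univ := by
    intro n
    induction n with
    | zero =>
      intro E _ _ _ _ _ T
      exact_mod_cast isCkFamilyOn_zero_iff.2 (Continuous.continuousOn (by fun_prop))
    | succ n ih =>
      intro E _ _ _ _ _ T
      exact isCkFamilyOn_succ (f' := fun _ => T.comp (ContinuousLinearMap.snd ℝ E E)) isOpen_univ
        (Continuous.continuousOn (by fun_prop)) (fun p _ h => T.hasDirDeriv p.2 h) (ih _)
  exact (isCkFamilyOn_of_nat fun n _ => key n T).mono (subset_univ Ω)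

lemma isCkFamilyOn_const {c : A → F} {S : Set A} (hc : ContinuousOn c S) (hΩ : ∀ p ∈ Ω, p.1 ∈ S) :
    IsCkFamilyOn k (fun a (_ : E) => c a) Ω := by
  have h0 : ∀ (j : ℕ) (a : A) (x : E) (h : Fin (j + 1) → E),
      iterDirDeriv (j + 1) (fun _ : E => c a) x h = 0 := by
    intro j a x h
    rw [iterDirDeriv_succ_eq isOpen_univ (f' := fun _ => 0) (fun x _ h => hasDirDeriv_const _ x h) j
      x (mem_univ _) h, iterDirDeriv_zero_fun]
  refine ⟨fun j hj p hp h => ?_, fun j hj => ?_⟩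
  · cases j with
    | zero => exact ⟨0, hasDirDeriv_const _ _ _⟩
    | succ j => exact ⟨0, by simpa only [h0] using hasDirDeriv_const _ _ _⟩
  · cases j with
    | zero =>
      exact hc.comp (f := fun q : (A × E) × (Fin 0 → E) => q.1.1) (by fun_prop)
        fun q hq => hΩ _ hq.1
    | succ j => simpa only [h0] using continuousOn_const

lemma IsCkFamilyOn.comp_param {B : Type*} [TopologicalSpace B] {β : B → A} {S : Set B}
    (hf : IsCkFamilyOn k f Ω) (hβ : ContinuousOn β S) {Ω' : Set (B × E)}
    (hΩ' : ∀ p ∈ Ω', p.1 ∈ S ∧ (β p.1, p.2) ∈ Ω) : IsCkFamilyOn k (fun b => f (β b)) Ω' where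
  exists_deriv j hj p hp h := hf.exists_deriv j hj (β p.1, p.2) (hΩ' p hp).2 h
  continuousOn j hj := (hf.continuousOn j hj).comp
    (f := fun q : (B × E) × (Fin j → E) => ((β q.1.1, q.1.2), q.2))
    (((hβ.comp (f := fun q : (B × E) × (Fin j → E) => q.1.1) (by fun_prop)
      fun q hq => (hΩ' _ hq.1).1).prodMk (by fun_prop)).prodMk (by fun_prop))
    fun q hq => ⟨(hΩ' _ hq.1).2, mem_univ _⟩

end Families

/-! ### `C^k` maps on open sets, and difference quotients -/

section SingleMaps

universe u
variable {E : Type u} [AddCommGroup E] [Module ℝ E] [TopologicalSpace E]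
  [IsTopologicalAddGroup E] [ContinuousSMul ℝ E]
  {F : Type*} [AddCommGroup F] [Module ℝ F] [TopologicalSpace F]
  [IsTopologicalAddGroup F] [ContinuousSMul ℝ F] [LocallyConvexSpace ℝ F] [T2Space F]
  {G : Type*} [AddCommGroup G] [Module ℝ G] [TopologicalSpace G]
  [IsTopologicalAddGroup G] [ContinuousSMul ℝ G] [LocallyConvexSpace ℝ G] [T2Space G]
  {k : ℕ∞} {f : E → F} {U : Set E}

lemma isOpen_snd_mem (hU : IsOpen U) : IsOpen {p : Unit × E | p.2 ∈ U} :=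
  hU.preimage continuous_snd

lemma IsCkOn.of_le {l : ℕ∞} (hf : IsCkOn k f U) (h : l ≤ k) : IsCkOn l f U :=
  (hf.family.of_le h).slice ()

lemma IsCkOn.congr {g : E → F} (hU : IsOpen U) (hf : IsCkOn k f U) (hfg : EqOn g f U) :
    IsCkOn k g U :=
  (hf.family.congr (g := fun _ => g) (isOpen_snd_mem hU) fun _ hp => hfg hp).slice ()

lemma isCkOn_of_local (hf : ∀ x ∈ U, ∃ V, IsOpen V ∧ x ∈ V ∧ IsCkOn k f V) : IsCkOn k f U :=
  (isCkFamilyOn_of_local (f := fun _ : Unit => f) (Ω := {p | p.2 ∈ U}) fun p hp =>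
    let ⟨V, hV, hpV, hfV⟩ := hf p.2 hp
    ⟨{p | p.2 ∈ V}, isOpen_snd_mem hV, hpV, hfV.family⟩).slice ()

lemma IsCkOn.continuousOn_self (hf : IsCkOn k f U) : ContinuousOn f U :=
  (hf.continuousOn 0 (by simp)).comp (f := fun p : E => (p, (Fin.elim0 : Fin 0 → E)))
    (by fun_prop) fun _ hp => ⟨hp, mem_univ _⟩

lemma IsCkOn.comp {g : F → G} {V : Set F} (hg : IsCkOn k g V) (hf : IsCkOn k f U)
    (hU : IsOpen U) (hV : IsOpen V) (h : MapsTo f U V) : IsCkOn k (fun x => g (f x)) U :=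
  (hg.family.comp (isOpen_snd_mem hU) (isOpen_snd_mem hV) hf.family fun _ hp => h hp).slice ()

lemma IsCkOn.prodMk {g : E → G} (hf : IsCkOn k f U) (hg : IsCkOn k g U) (hU : IsOpen U) :
    IsCkOn k (fun x => (f x, g x)) U :=
  (hf.family.prodMk (isOpen_snd_mem hU) hg.family).slice ()

lemma ContinuousLinearMap.isCkOn (T : E →L[ℝ] F) (U : Set E) : IsCkOn k T U :=
  (isCkFamilyOn_linear (A := Unit) T {p | p.2 ∈ U}).slice ()

lemma isCkOn_const (c : F) (U : Set E) : IsCkOn k (fun _ : E => c) U :=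
  (isCkFamilyOn_const (A := Unit) (Ω := {p | p.2 ∈ U}) (S := univ) (c := fun _ => c)
    continuousOn_const fun _ _ => mem_univ _).slice ()

lemma IsCkOn.dirDeriv {n : ℕ} (hU : IsOpen U) (hf : IsCkOn ((n + 1 : ℕ) : ℕ∞) f U) :
    IsCkOn n (fun q : E × E => dirDeriv f q.1 q.2) {q | q.1 ∈ U} :=
  (hf.family.dirDeriv (isOpen_snd_mem hU)).slice ()

lemma isCkOn_top_iff : IsCkOn ⊤ f U ↔ ∀ n : ℕ, IsCkOn n f U :=
  ⟨fun h _ => h.of_le le_top, fun h => (isCkFamilyOn_of_nat fun n _ => (h n).family).slice ()⟩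

lemma IsCkOn.dirDeriv_top (hU : IsOpen U) (hf : IsCkOn ⊤ f U) :
    IsCkOn ⊤ (fun q : E × E => _root_.dirDeriv f q.1 q.2) {q | q.1 ∈ U} :=
  isCkOn_top_iff.2 fun _ => (hf.of_le le_top).dirDeriv hU

lemma isCkOn_zero_iff : IsCkOn 0 f U ↔ ContinuousOn f U := by
  refine ⟨fun h => h.continuousOn_self, fun h => ((isCkFamilyOn_zero_iff (f := fun _ : Unit => f)
    (Ω := {p | p.2 ∈ U})).2 (h.comp (f := Prod.snd) (by fun_prop) fun p hp => hp)).slice ()⟩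

lemma isCkOn_succ (hU : IsOpen U) {f' : E × E → F} {n : ℕ} (hc : ContinuousOn f U)
    (hd : ∀ x ∈ U, ∀ h, HasDirDeriv f x h (f' (x, h))) (hf' : IsCkOn n f' {q | q.1 ∈ U}) :
    IsCkOn ((n + 1 : ℕ) : ℕ∞) f U :=
  (isCkFamilyOn_succ (f := fun _ : Unit => f) (f' := fun _ => f') (isOpen_snd_mem hU)
    (hc.comp (f := Prod.snd) (by fun_prop) fun p hp => hp) (fun p hp h => hd p.2 hp h)
    hf'.family).slice ()

lemma IsCkOn.hasDirDeriv_dirDeriv (hf : IsCkOn k f U) (hk : 1 ≤ k) {x : E} (hx : x ∈ U) (h : E) :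
    HasDirDeriv f x h (_root_.dirDeriv f x h) :=
  (hf.family (A := Unit)).hasDirDeriv hk (p := ((), x)) hx h

/-- The difference quotient `(f (x + t h) - f x) / t`, extended to `t = 0` by the derivative. -/
def slopeMap (f : E → F) (t : ℝ) (q : E × E) : F :=
  if t = 0 then dirDeriv f q.1 q.2 else t⁻¹ • (f (q.1 + t • q.2) - f q.1)

lemma isOpen_slopeMap_domain (hU : IsOpen U) :
    IsOpen {p : ℝ × E × E | p.2.1 ∈ U ∧ p.2.1 + p.1 • p.2.2 ∈ U} :=
  (hU.preimage (by fun_prop)).inter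
    (hU.preimage (f := fun p : ℝ × E × E => p.2.1 + p.1 • p.2.2) (by fun_prop))

/-- At a point with `t = 0` the neighbourhood filter splits into the part `t ≠ 0`, where
`tendsto_slope` gives joint convergence, and the part `t = 0`, where continuity of the derivative
suffices. -/
lemma continuousOn_slopeMap (hU : IsOpen U) (hf : IsCkOn 1 f U) :
    ContinuousOn (fun p : ℝ × E × E => slopeMap f p.1 p.2)
      {p : ℝ × E × E | p.2.1 ∈ U ∧ p.2.1 + p.1 • p.2.2 ∈ U} := by
  intro p hp
  refine ContinuousAt.continuousWithinAt ?_
  rcases eq_or_ne p.1 0 with h0 | h0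
  · obtain ⟨t, x, h⟩ := p
    obtain rfl : t = 0 := h0
    have hx : x ∈ U := hp.1
    have hd := hf.family (A := Unit)
    have hdc := hd.continuousOn_dirDeriv le_rfl
    have hs := tendsto_slope (f := fun _ : Unit => f) (f' := fun _ x h => dirDeriv f x h)
      (Ω := {p | p.2 ∈ U}) (isOpen_snd_mem hU)
      (fun p hp h => hf.hasDirDeriv_dirDeriv le_rfl hp h) hdc
      (p := ((), x)) hx h
    have hcont : Continuous (fun p : ℝ × E × E => (((((), p.2.1), p.2.2), p.1) :
        ((Unit × E) × E) × ℝ)) := by fun_prop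
    have ht := hcont.tendsto (0, x, h)
    have h1 : Tendsto (fun p : ℝ × E × E => slopeMap f p.1 p.2)
        (𝓝 (0, x, h) ⊓ 𝓟 {p | p.1 ≠ 0}) (𝓝 (dirDeriv f x h)) := by
      refine (hs.comp (f := fun p : ℝ × E × E => ((((), p.2.1), p.2.2), p.1))
        (tendsto_inf.2 ⟨ht.mono_left inf_le_left, ?_⟩)).congr' ?_
      · exact tendsto_principal.2 (eventually_inf_principal.2 (Eventually.of_forall fun p hp => hp))
      · refine eventually_inf_principal.2 (Eventually.of_forall fun p hp => ?_)
        simp [slopeMap, show p.1 ≠ 0 from hp]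
    have h2 : Tendsto (fun p : ℝ × E × E => slopeMap f p.1 p.2)
        (𝓝 (0, x, h) ⊓ 𝓟 {p | p.1 ≠ 0}ᶜ) (𝓝 (dirDeriv f x h)) := by
      have hc := (hdc.continuousAt
        (((isOpen_snd_mem hU).prod isOpen_univ).mem_nhds
          (show (((), x), h) ∈ _ from ⟨hx, mem_univ _⟩))).tendsto
      have ht' : Tendsto (fun p : ℝ × E × E => (((), p.2.1), p.2.2)) (𝓝 (0, x, h))
          (𝓝 (((), x), h)) := Continuous.tendsto' (by fun_prop) _ _ rfl
      refine ((hc.comp ht').mono_left inf_le_left).congr' ?_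
      refine eventually_inf_principal.2 (Eventually.of_forall fun p hp => ?_)
      simp [slopeMap, show p.1 = 0 by simpa using hp]
    have h3 := h1.sup h2
    rw [← inf_sup_left, sup_principal, union_compl_self, principal_univ, inf_top_eq] at h3
    simpa [ContinuousAt, slopeMap] using h3
  · have hc : ContinuousAt (fun p : ℝ × E × E => p.1⁻¹ • (f (p.2.1 + p.1 • p.2.2) - f p.2.1)) p := by
      have hfc := hf.continuousOn_self
      have h1 : ContinuousAt (fun p : ℝ × E × E => f (p.2.1 + p.1 • p.2.2)) p :=
        ContinuousAt.comp (g := f) (f := fun p : ℝ × E × E => p.2.1 + p.1 • p.2.2)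
          (hfc.continuousAt (hU.mem_nhds hp.2)) (Continuous.continuousAt (by fun_prop))
      have h2 : ContinuousAt (fun p : ℝ × E × E => f p.2.1) p :=
        ContinuousAt.comp (g := f) (f := fun p : ℝ × E × E => p.2.1)
          (hfc.continuousAt (hU.mem_nhds hp.1)) (Continuous.continuousAt (by fun_prop))
      exact (continuousAt_fst.inv₀ h0).smul (h1.sub h2)
    refine hc.congr ?_
    filter_upwards [continuousAt_fst.eventually_ne h0] with q hq
    simp [slopeMap, hq]

/-- The difference quotient of a smooth map is a continuous family of smooth maps. -/
lemma isCkFamilyOn_slopeMap (n : ℕ) : ∀ {E : Type u} [AddCommGroup E] [Module ℝ E]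
    [TopologicalSpace E] [IsTopologicalAddGroup E] [ContinuousSMul ℝ E] {f : E → F} {U : Set E}
    (_ : IsOpen U) (_ : IsCkOn ((n + 1 : ℕ) : ℕ∞) f U),
    IsCkFamilyOn n (slopeMap f) {p : ℝ × E × E | p.2.1 ∈ U ∧ p.2.1 + p.1 • p.2.2 ∈ U} := by
  induction n with
  | zero =>
    intro E _ _ _ _ _ f U hU hf
    exact_mod_cast isCkFamilyOn_zero_iff.2 (continuousOn_slopeMap hU (by exact_mod_cast hf))
  | succ n ih =>
    intro E _ _ _ _ _ f U hU hf
    have h1 : (1 : ℕ∞) ≤ ((n + 1 : ℕ) : ℕ∞) := by exact_mod_cast Nat.le_add_left 1 n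
    have h2 : ((n + 1 : ℕ) : ℕ∞) ≤ ((n + 1 + 1 : ℕ) : ℕ∞) := by exact_mod_cast Nat.le_succ _
    have hU' : IsOpen {q : E × E | q.1 ∈ U} := hU.preimage continuous_fst
    have hdf := hf.dirDeriv hU
    -- The derivative of `slopeMap f t` at `(x, v)` along `(u, w)` is the slope of `df` at `(x, u)`
    -- in direction `(v, w)`; `flip` exchanges the two inner components.
    let flip : ((E × E) × (E × E)) →L[ℝ] ((E × E) × (E × E)) :=
      (((ContinuousLinearMap.fst ℝ E E).comp (ContinuousLinearMap.fst ℝ _ _)).prod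
        ((ContinuousLinearMap.fst ℝ E E).comp (ContinuousLinearMap.snd ℝ _ _))).prod
      (((ContinuousLinearMap.snd ℝ E E).comp (ContinuousLinearMap.fst ℝ _ _)).prod
        ((ContinuousLinearMap.snd ℝ E E).comp (ContinuousLinearMap.snd ℝ _ _)))
    have hf' := ((ih hU' hdf).comp_linear (isOpen_slopeMap_domain hU') flip)
    have hc := continuousOn_slopeMap hU (hf.of_le (h1.trans h2))
    refine isCkFamilyOn_succ (isOpen_slopeMap_domain hU) hc ?_ hf'
    have hne : ∀ p ∈ {p : ℝ × E × E | p.2.1 ∈ U ∧ p.2.1 + p.1 • p.2.2 ∈ U}, p.1 ∈ ({0}ᶜ : Set ℝ) →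
        ∀ h, HasDirDeriv (slopeMap f p.1) p.2 h
          (slopeMap (fun q : E × E => dirDeriv f q.1 q.2) p.1 (flip (p.2, h))) := by
      rintro ⟨t, x, v⟩ ⟨hx, hxv⟩ ht ⟨u, w⟩
      have ht' : t ≠ 0 := ht
      have e1 : HasDirDeriv (fun q : E × E => f q.1) (x, v) (u, w) (dirDeriv f x u) :=
        hf.hasDirDeriv_dirDeriv (h1.trans h2) hx u
      have e2 : HasDirDeriv (fun q : E × E => f (q.1 + t • q.2)) (x, v) (u, w)
          (dirDeriv f (x + t • v) (u + t • w)) := by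
        refine (hf.hasDirDeriv_dirDeriv (h1.trans h2) hxv (u + t • w)).congr fun s => ?_
        have : x + t • v + s • (u + t • w) = x + s • u + t • (v + s • w) := by
          simp only [smul_add, smul_comm s t]
          abel
        change _ = s⁻¹ • (f (x + s • u + t • (v + s • w)) - f (x + t • v))
        rw [← this]
      have e3 := (e2.add (e1.const_smul (-1))).const_smul t⁻¹
      have e4 : slopeMap f t = fun q : E × E => t⁻¹ • (f (q.1 + t • q.2) + (-1 : ℝ) • f q.1) := by
        funext q
        simp [slopeMap, ht', sub_eq_add_neg]
      simpa [e4, slopeMap, ht', flip, sub_eq_add_neg] using e3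
    intro p hp h
    -- The formula is an explicit computation for `t ≠ 0`. Such `t` are dense and both sides are
    -- continuous, so it extends to `t = 0` without computing second derivatives.
    refine hasDirDeriv_of_mem_closure (B := ({0}ᶜ : Set ℝ))
      (f' := fun t q h => slopeMap (fun q : E × E => dirDeriv f q.1 q.2) t (flip (q, h)))
      (isOpen_slopeMap_domain hU) hc hne ?_ hp (by simp) h
    exact hf'.continuousOn_zero.comp (f := fun q : (ℝ × E × E) × E × E => (q.1.1, q.1.2, q.2))
      (by fun_prop) fun q hq => hq.1

end SingleMaps

/-! ### The topology of `C^r(M, E)` -/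

namespace CkMap

variable {F : Type*} [NormedAddCommGroup F] [NormedSpace ℝ F] [FiniteDimensional ℝ F]
  {M : Type*} [TopologicalSpace M] [ChartedSpace F M]
  {E : Type*} [AddCommGroup E] [Module ℝ E] [TopologicalSpace E]
  [IsTopologicalAddGroup E] [ContinuousSMul ℝ E] [LocallyConvexSpace ℝ E] [T2Space E]
  {E' : Type*} [AddCommGroup E'] [Module ℝ E'] [TopologicalSpace E']
  [IsTopologicalAddGroup E'] [ContinuousSMul ℝ E'] [LocallyConvexSpace ℝ E'] [T2Space E']
  {r : ℕ∞}

/-- Chart images are locally compact because `F` is finite-dimensional, and this makes evaluation on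
`C(V × F^j, E)` jointly continuous. -/
lemma isCkFamilyOn_eval {φ : OpenPartialHomeomorph M F} (hφ : φ ∈ atlas F M) :
    IsCkFamilyOn r (fun (ξ : CkMap F M E E r) x => ξ (φ.symm x)) {p | p.2 ∈ φ.target} where
  exists_deriv j hj p hp h := ((isCkMapOn_vector_iff.1 p.1.isCk).2 φ hφ).exists_deriv j hj p.2 hp h
  continuousOn j hj := by
    have : ProperSpace F := FiniteDimensional.proper_real F
    have : LocallyCompactSpace φ.target := φ.open_target.locallyCompactSpace
    rw [continuousOn_iff_continuous_domRestrict]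
    have h1 : Continuous fun q : ((({p : CkMap F M E E r × F | p.2 ∈ φ.target}) ×ˢ univ :
        Set ((CkMap F M E E r × F) × (Fin j → F)))) =>
        chartDeriv ⟨φ, hφ⟩ ⟨j, hj⟩ q.1.1.1 (⟨q.1.1.2, q.2.1⟩, q.1.2) :=
      (((continuous_chartDeriv (E := E) (r := r) ⟨φ, hφ⟩ ⟨j, hj⟩).comp
        (by fun_prop : Continuous fun q : ((({p : CkMap F M E E r × F | p.2 ∈ φ.target}) ×ˢ univ :
          Set ((CkMap F M E E r × F) × (Fin j → F)))) => q.1.1.1))).eval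
        ((Continuous.subtype_mk (by fun_prop) _).prodMk (by fun_prop))
    exact h1

/-- The half of the exponential law that is mere currying. Together with
`isCkFamilyOn_of_continuousOn` it translates continuity in the `C^r`-topology into calculus of
families. -/
lemma continuousOn_of_isCkFamilyOn {B : Type*} [TopologicalSpace B] {Ξ : B → CkMap F M E E r}
    {S : Set B} (h : ∀ φ ∈ atlas F M,
      IsCkFamilyOn r (fun b x => Ξ b (φ.symm x)) {p | p.1 ∈ S ∧ p.2 ∈ φ.target}) :
    ContinuousOn Ξ S := by
  rw [continuousOn_iff_continuous_domRestrict]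
  refine continuous_iInf_rng.2 fun φ => continuous_iInf_rng.2 fun j => continuous_induced_rng.2 ?_
  refine ContinuousMap.continuous_of_continuous_uncurry _ ?_
  exact ((h φ.1 φ.2).continuousOn j.1 j.2).comp_continuous
    (f := fun q : S × (φ.1.target × (Fin j.1 → F)) => (((q.1 : B), (q.2.1 : F)), q.2.2))
    (by fun_prop) fun q => ⟨⟨q.1.2, q.2.1.2⟩, mem_univ _⟩

lemma isCkFamilyOn_of_continuousOn {B : Type*} [TopologicalSpace B] {Ξ : B → CkMap F M E E r}
    {S : Set B} (h : ContinuousOn Ξ S) {φ : OpenPartialHomeomorph M F} (hφ : φ ∈ atlas F M) :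
    IsCkFamilyOn r (fun b x => Ξ b (φ.symm x)) {p | p.1 ∈ S ∧ p.2 ∈ φ.target} :=
  (isCkFamilyOn_eval hφ).comp_param h fun _ hp => hp

lemma isCkMapOn_vector_of_charts {f : M → E}
    (h : ∀ φ ∈ atlas F M, IsCkOn r (fun x => f (φ.symm x)) φ.target) : IsCkMapOn F E r f univ := by
  refine isCkMapOn_vector_iff.2 ⟨continuous_iff_continuousAt.2 fun m => ?_, h⟩
  have h1 := (h _ (chart_mem_atlas F m)).continuousOn_self.continuousAt
    ((chartAt F m).open_target.mem_nhds (mem_chart_target F m))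
  have h2 := ContinuousAt.comp (f := chartAt F m) (x := m) h1
    ((chartAt F m).continuousAt (mem_chart_source F m))
  refine h2.congr ?_
  filter_upwards [(chartAt F m).open_source.mem_nhds (mem_chart_source F m)] with m' hm'
  simp [(chartAt F m).left_inv hm']

lemma continuous_eval : Continuous fun p : CkMap F M E E r × M => p.1 p.2 := by
  refine continuous_iff_continuousAt.2 fun p => ?_
  have hm := mem_chart_source F p.2
  have h1 := (isCkFamilyOn_eval (E := E) (r := r) (chart_mem_atlas F p.2)).continuousOn_zero
    |>.continuousAt (x := (p.1, chartAt F p.2 p.2))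
      (((chartAt F p.2).open_target.preimage continuous_snd).mem_nhds (mem_chart_target F p.2))
  have h2 : ContinuousAt (fun q : CkMap F M E E r × M => (q.1, chartAt F p.2 q.2)) p :=
    continuousAt_fst.prodMk (((chartAt F p.2).continuousAt hm).comp continuousAt_snd)
  refine (ContinuousAt.comp (f := fun q : CkMap F M E E r × M => (q.1, chartAt F p.2 q.2))
    h1 h2).congr ?_
  filter_upwards [((chartAt F p.2).open_source.preimage continuous_snd).mem_nhds hm] with q hq
  simp [(chartAt F p.2).left_inv hq]

/-- Tube lemma over the compact `M`, applied to the jointly continuous evaluation. It makes the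
domains of charts and words in the mapping group open. -/
lemma isOpen_forall_mem [CompactSpace M] {W : Set (M × E)} (hW : IsOpen W) :
    IsOpen {ξ : CkMap F M E E r | ∀ m, (m, ξ m) ∈ W} := by
  refine isOpen_iff_mem_nhds.2 fun ξ hξ => ?_
  have := isCompact_univ.eventually_forall_of_forall_eventually (x₀ := ξ) (K := (univ : Set M))
    (P := fun ξ m => (m, ξ m) ∈ W) fun m _ =>
      (continuous_snd.prodMk continuous_eval).continuousAt.eventually (hW.mem_nhds (hξ m))
  filter_upwards [this] with η hη m using hη m (mem_univ m)

/-- The isomorphism `C^r(M, E) × C^r(M, E') → C^r(M, E × E')`, as a continuous linear map. -/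
def prodL : CkMap F M E E r × CkMap F M E' E' r →L[ℝ] CkMap F M (E × E') (E × E') r where
  toFun p := ⟨fun m => (p.1 m, p.2 m), isCkMapOn_vector_of_charts fun φ hφ =>
    ((isCkMapOn_vector_iff.1 p.1.isCk).2 φ hφ).prodMk ((isCkMapOn_vector_iff.1 p.2.isCk).2 φ hφ)
      φ.open_target⟩
  map_add' _ _ := rfl
  map_smul' _ _ := rfl
  cont := by
    rw [← continuousOn_univ]
    refine continuousOn_of_isCkFamilyOn fun φ hφ => ?_
    exact (isCkFamilyOn_of_continuousOn continuousOn_fst hφ).prodMk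
      (isOpen_univ.prod φ.open_target) (isCkFamilyOn_of_continuousOn continuousOn_snd hφ)

end CkMap

/-! ### Smoothness of pushforwards between spaces of `C^r` maps -/

section Pushforward

universe v w

variable {F : Type*} [NormedAddCommGroup F] [NormedSpace ℝ F] [FiniteDimensional ℝ F]
  {M : Type*} [TopologicalSpace M] [ChartedSpace F M]
  {P : Type*} [AddCommGroup P] [Module ℝ P] [TopologicalSpace P]
  [IsTopologicalAddGroup P] [ContinuousSMul ℝ P] [LocallyConvexSpace ℝ P] [T2Space P]
  {X : Type v} [AddCommGroup X] [Module ℝ X] [TopologicalSpace X]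
  [IsTopologicalAddGroup X] [ContinuousSMul ℝ X] [LocallyConvexSpace ℝ X] [T2Space X]
  {Y : Type*} [AddCommGroup Y] [Module ℝ Y] [TopologicalSpace Y]
  [IsTopologicalAddGroup Y] [ContinuousSMul ℝ Y] [LocallyConvexSpace ℝ Y] [T2Space Y]
  {r : ℕ∞}

variable (F P r) in
/-- `h : M × X → Y` is, locally on `W`, of the form `h (m, y) = H (γ m, y)` with a smooth map `H`
and a `C^r` map `γ` with values in `P`. -/
def IsFibrewiseSmoothOn (h : M → X → Y) (W : Set (M × X)) : Prop :=
  ∀ φ ∈ atlas F M, ∀ x ∈ φ.target, ∀ y, (φ.symm x, y) ∈ W →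
    ∃ (γ : F → P) (N : Set F) (O : Set (P × X)) (H : P × X → Y),
      IsOpen N ∧ x ∈ N ∧ IsCkOn r γ N ∧ IsOpen O ∧ IsCkOn ⊤ H O ∧ (γ x, y) ∈ O ∧
      ∀ x' ∈ N, ∀ y', (γ x', y') ∈ O → h (φ.symm x') y' = H (γ x', y')

variable {h : M → X → Y} {W : Set (M × X)}

/-- Only the fibre variable is differentiated: `γ` stays, and `H` is replaced by its partial
derivative, so no regularity in `m` is lost. -/
lemma IsFibrewiseSmoothOn.dirDeriv (hh : IsFibrewiseSmoothOn F P r h W) :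
    IsFibrewiseSmoothOn F P r (fun m (q : X × X) => dirDeriv (h m) q.1 q.2)
      {p | (p.1, p.2.1) ∈ W} := by
  intro φ hφ x hx y hy
  obtain ⟨γ, N, O, H, hN, hxN, hγ, hO, hH, hxO, hrep⟩ := hh φ hφ x hx y.1 hy
  let T : P × X × X →L[ℝ] (P × X) × (P × X) :=
    ((ContinuousLinearMap.fst ℝ P (X × X)).prod
      ((ContinuousLinearMap.fst ℝ X X).comp (ContinuousLinearMap.snd ℝ P (X × X)))).prod
    ((0 : P × X × X →L[ℝ] P).prod
      ((ContinuousLinearMap.snd ℝ X X).comp (ContinuousLinearMap.snd ℝ P (X × X))))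
  have hO' : IsOpen {p : P × X × X | (p.1, p.2.1) ∈ O} := hO.preimage (by fun_prop)
  refine ⟨γ, N, {p | (p.1, p.2.1) ∈ O}, fun p => _root_.dirDeriv H (T p).1 (T p).2, hN, hxN, hγ,
    hO', ?_, hxO, ?_⟩
  · exact (hH.dirDeriv_top hO).comp (T.isCkOn _) hO' (hO.preimage continuous_fst) fun p hp => hp
  · intro x' hx' y' hy'
    have hslice : IsOpen {z : X | (γ x', z) ∈ O} := hO.preimage (by fun_prop)
    refine (dirDeriv_congr_of_eventuallyEq (f := fun z => H (γ x', z)) y'.2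
      (eventually_of_mem (hslice.mem_nhds hy') fun z hz => hrep x' hx' z hz)).trans ?_
    simp [_root_.dirDeriv, T]

namespace CkMap

/-- The map `ξ ↦ h(·, ξ(·))` between spaces of `C^r` maps. -/
def pushforward (h : M → X → Y) (ξ : CkMap F M X X r) : CkMap F M Y Y r :=
  open Classical in
  if hξ : IsCkMapOn F Y r (fun m => h m (ξ m)) univ then ⟨fun m => h m (ξ m), hξ⟩ else 0

/-- In a chart the composite is locally `H (γ x, Ξ b (φ.symm x))`. The chain rule for families gives
regularity in `x` and continuity in `b` at once. -/
lemma isCkFamilyOn_pushforward (hh : IsFibrewiseSmoothOn F P r h W) {B : Type*}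
    [TopologicalSpace B] {Ξ : B → CkMap F M X X r} {S : Set B} (hS : IsOpen S)
    (hΞ : ContinuousOn Ξ S) (hW : ∀ b ∈ S, ∀ m, (m, Ξ b m) ∈ W)
    {φ : OpenPartialHomeomorph M F} (hφ : φ ∈ atlas F M) :
    IsCkFamilyOn r (fun b x => h (φ.symm x) (Ξ b (φ.symm x))) {p | p.1 ∈ S ∧ p.2 ∈ φ.target} := by
  refine isCkFamilyOn_of_local fun p hp => ?_
  obtain ⟨γ, N, O, H, hN, hxN, hγ, hO, hH, hxO, hrep⟩ := hh φ hφ p.2 hp.2 _ (hW p.1 hp.1 _)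
  have hΩ : IsOpen {p : B × F | p.1 ∈ S ∧ p.2 ∈ φ.target ∩ N} :=
    hS.prod (φ.open_target.inter hN)
  have hf : IsCkFamilyOn r (fun b x => (γ x, Ξ b (φ.symm x)))
      {p : B × F | p.1 ∈ S ∧ p.2 ∈ φ.target ∩ N} :=
    (hγ.family.mono fun p hp => hp.2.2).prodMk hΩ
      ((isCkFamilyOn_of_continuousOn hΞ hφ).mono fun p hp => ⟨hp.1, hp.2.1⟩)
  have hΩ' := hf.continuousOn_zero.isOpen_inter_preimage hΩ hO
  refine ⟨_, hΩ', ⟨⟨hp.1, hp.2, hxN⟩, hxO⟩, ?_⟩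
  refine IsCkFamilyOn.congr hΩ' (f := fun b x => H (γ x, Ξ b (φ.symm x))) ?_
    fun q hq => hrep q.2 hq.1.2.2 _ hq.2
  exact (hH.of_le le_top).family.comp hΩ' (hO.preimage continuous_snd) (hf.mono inter_subset_left)
    fun q hq => hq.2

lemma pushforward_apply (hh : IsFibrewiseSmoothOn F P r h W) {ξ : CkMap F M X X r}
    (hξ : ∀ m, (m, ξ m) ∈ W) (m : M) : pushforward h ξ m = h m (ξ m) := by
  have : IsCkMapOn F Y r (fun m => h m (ξ m)) univ := isCkMapOn_vector_of_charts fun φ hφ =>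
    ((isCkFamilyOn_pushforward hh (B := Unit) (Ξ := fun _ => ξ) isOpen_univ continuousOn_const
      (fun _ _ => hξ) hφ).slice ()).mono fun x hx => ⟨mem_univ _, hx⟩
  rw [pushforward, dif_pos this]
  rfl

lemma continuousOn_pushforward (hh : IsFibrewiseSmoothOn F P r h W) {B : Type*}
    [TopologicalSpace B] {Ξ : B → CkMap F M X X r} {S : Set B} (hS : IsOpen S)
    (hΞ : ContinuousOn Ξ S) (hW : ∀ b ∈ S, ∀ m, (m, Ξ b m) ∈ W) :
    ContinuousOn (fun b => pushforward h (Ξ b)) S :=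
  continuousOn_of_isCkFamilyOn fun φ hφ =>
    (isCkFamilyOn_pushforward hh hS hΞ hW hφ).congr (hS.prod φ.open_target)
      fun p hp => pushforward_apply hh (hW p.1 hp.1) _

/-- Convergence of the difference quotients in `C^r(M, Y)` is continuity at `0` of the curve `q`
that equals the quotient for `t ≠ 0` and the candidate derivative at `t = 0`. In a chart `q` is
`slopeMap H` composed with `C^r` data, hence a `C^r` family. -/
lemma hasDirDeriv_pushforward [CompactSpace M] (hWo : IsOpen W)
    (hh : IsFibrewiseSmoothOn F P r h W) {ξ : CkMap F M X X r} (hξ : ∀ m, (m, ξ m) ∈ W)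
    (η : CkMap F M X X r) :
    HasDirDeriv (pushforward h) ξ η
      (pushforward (fun m (q : X × X) => dirDeriv (h m) q.1 q.2) (prodL (ξ, η))) := by
  have hh' := hh.dirDeriv
  let S : Set ℝ := {t | ∀ m, (m, (ξ + t • η) m) ∈ W}
  have hline : Continuous fun t : ℝ => ξ + t • η := by fun_prop
  have hS : IsOpen S := (isOpen_forall_mem hWo).preimage hline
  have h0 : (0 : ℝ) ∈ S := by simpa [S] using hξ
  let q : ℝ → CkMap F M Y Y r := fun t => if t = 0 then
    pushforward (fun m (q : X × X) => dirDeriv (h m) q.1 q.2) (prodL (ξ, η))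
    else t⁻¹ • (pushforward h (ξ + t • η) - pushforward h ξ)
  have hne : ContinuousOn q (S ∩ {0}ᶜ) := by
    have : ContinuousOn (fun t : ℝ => t⁻¹ • (pushforward h (ξ + t • η) - pushforward h ξ))
        (S ∩ {0}ᶜ) :=
      (continuousOn_id.inv₀ fun t ht => ht.2).smul
        (((continuousOn_pushforward hh hS hline.continuousOn fun t ht => ht).mono
          inter_subset_left).sub continuousOn_const)
    exact this.congr fun t ht => if_neg ht.2
  have hq : ContinuousOn q S := by
    refine continuousOn_of_isCkFamilyOn fun φ hφ => isCkFamilyOn_of_local fun p hp => ?_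
    by_cases hp0 : p.1 = 0
    · obtain ⟨γ, N, O, H, hN, hxN, hγ, hO, hH, hxO, hrep⟩ := hh φ hφ p.2 hp.2 _ (hξ _)
      -- The base point is `(γ x, ξ)` and the direction `(0, η)`: its `P`-component vanishes because
      -- `γ` does not move with `t`.
      let f : ℝ → F → (P × X) × (P × X) := fun _ x => ((γ x, ξ (φ.symm x)), (0, η (φ.symm x)))
      have hΩ : IsOpen {p : ℝ × F | p.1 ∈ S ∧ p.2 ∈ φ.target ∩ N} :=
        hS.prod (φ.open_target.inter hN)
      have hvec : ∀ ζ : CkMap F M X X r, IsCkFamilyOn r (fun (_ : ℝ) x => ζ (φ.symm x))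
          {p : ℝ × F | p.1 ∈ S ∧ p.2 ∈ φ.target ∩ N} := fun ζ =>
        ((isCkMapOn_vector_iff.1 ζ.isCk).2 φ hφ).family.mono fun p hp => hp.2.1
      have hf : IsCkFamilyOn r f {p : ℝ × F | p.1 ∈ S ∧ p.2 ∈ φ.target ∩ N} :=
        ((hγ.family.mono fun p hp => hp.2.2).prodMk hΩ (hvec ξ)).prodMk hΩ
          ((isCkOn_const 0 univ).family.mono (fun _ _ => mem_univ _) |>.prodMk hΩ (hvec η))
      have hΩ' := (continuousOn_fst.prodMk hf.continuousOn_zero).isOpen_inter_preimage hΩ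
        (isOpen_slopeMap_domain hO)
      have hslope : IsCkFamilyOn r (slopeMap H) _ :=
        isCkFamilyOn_of_nat fun n _ => isCkFamilyOn_slopeMap n hO (hH.of_le le_top)
      refine ⟨_, hΩ', ⟨⟨hp.1, hp.2, hxN⟩, ?_⟩, IsCkFamilyOn.congr hΩ'
        (hslope.comp hΩ' (isOpen_slopeMap_domain hO) (hf.mono inter_subset_left)
          fun q hq => hq.2) ?_⟩
      · simpa [hp0, f] using hxO
      · rintro ⟨t, x⟩ ⟨⟨ht, hx, hxN'⟩, hx1, hx2⟩
        have hx1' : (γ x, ξ (φ.symm x)) ∈ O := hx1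
        have hx2' : (γ x, ξ (φ.symm x) + t • η (φ.symm x)) ∈ O := by simpa [f] using hx2
        by_cases ht0 : t = 0
        · have hslice : IsOpen {z : X | (γ x, z) ∈ O} := hO.preimage (by fun_prop)
          have e : pushforward (fun m (q : X × X) => dirDeriv (h m) q.1 q.2) (prodL (ξ, η))
              (φ.symm x) = dirDeriv (h (φ.symm x)) (ξ (φ.symm x)) (η (φ.symm x)) :=
            pushforward_apply hh' (ξ := prodL (ξ, η)) hξ _
          simp only [q, ht0, if_true, slopeMap, f, e]
          rw [dirDeriv_congr_of_eventuallyEq (f := fun z => H (γ x, z)) _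
            (eventually_of_mem (hslice.mem_nhds hx1') fun z hz => hrep x hxN' z hz)]
          simp [dirDeriv]
        · have e1 : pushforward h (ξ + t • η) (φ.symm x) = H (γ x, ξ (φ.symm x) + t • η (φ.symm x)) :=
            (pushforward_apply hh ht _).trans (hrep x hxN' _ hx2')
          have e2 : pushforward h ξ (φ.symm x) = H (γ x, ξ (φ.symm x)) :=
            (pushforward_apply hh hξ _).trans (hrep x hxN' _ hx1')
          simp [q, ht0, slopeMap, f, e1, e2, sub_eq_add_neg]
    · have hop : IsOpen {p : ℝ × F | p.1 ∈ S ∩ {0}ᶜ ∧ p.2 ∈ φ.target} :=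
        (hS.inter isOpen_compl_singleton).prod φ.open_target
      exact ⟨_, hop, ⟨⟨hp.1, hp0⟩, hp.2⟩, isCkFamilyOn_of_continuousOn hne hφ⟩
  have hlim := (hq.continuousAt (hS.mem_nhds h0)).tendsto.mono_left
    (nhdsWithin_le_nhds (s := {0}ᶜ))
  simp only [q, if_true] at hlim
  refine hlim.congr' ?_
  filter_upwards [self_mem_nhdsWithin] with t ht
  exact if_neg ht

/-- Pushforwards by fibrewise smooth maps are smooth. -/
theorem isCkOn_pushforward [CompactSpace M] {Z : Type w} [AddCommGroup Z] [Module ℝ Z]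
    [TopologicalSpace Z] [IsTopologicalAddGroup Z] [ContinuousSMul ℝ Z]
    (L : Z →L[ℝ] CkMap F M X X r) (hWo : IsOpen W) (hh : IsFibrewiseSmoothOn F P r h W) :
    IsCkOn ⊤ (fun z => pushforward h (L z)) {z | ∀ m, (m, L z m) ∈ W} := by
  -- The derivative depends on a point of `Z × Z`, while its fibrewise map takes arguments in `X ×
  -- X`. Carrying the linear map `L` along lets `prodL` join the two, with `L' (z, w) = (L z, L w)`.
  have key : ∀ n : ℕ, ∀ {Z : Type w} [AddCommGroup Z] [Module ℝ Z]
      [TopologicalSpace Z] [IsTopologicalAddGroup Z] [ContinuousSMul ℝ Z]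
      {X : Type v} [AddCommGroup X] [Module ℝ X] [TopologicalSpace X]
      [IsTopologicalAddGroup X] [ContinuousSMul ℝ X] [LocallyConvexSpace ℝ X] [T2Space X]
      {h : M → X → Y} {W : Set (M × X)} (L : Z →L[ℝ] CkMap F M X X r) (_ : IsOpen W)
      (_ : IsFibrewiseSmoothOn F P r h W),
      IsCkOn n (fun z => pushforward h (L z)) {z | ∀ m, (m, L z m) ∈ W} := by
    intro n
    induction n with
    | zero =>
      intro Z _ _ _ _ _ X _ _ _ _ _ _ _ h W L hWo hh
      exact_mod_cast isCkOn_zero_iff.2 (continuousOn_pushforward hh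
        ((isOpen_forall_mem hWo).preimage L.continuous) L.continuous.continuousOn fun z hz => hz)
    | succ n ih =>
      intro Z _ _ _ _ _ X _ _ _ _ _ _ _ h W L hWo hh
      have hD : IsOpen {z | ∀ m, (m, L z m) ∈ W} := (isOpen_forall_mem hWo).preimage L.continuous
      let L' : Z × Z →L[ℝ] CkMap F M (X × X) (X × X) r := prodL.comp
        ((L.comp (ContinuousLinearMap.fst ℝ Z Z)).prod (L.comp (ContinuousLinearMap.snd ℝ Z Z)))
      refine isCkOn_succ hD (continuousOn_pushforward hh hD L.continuous.continuousOn fun z hz => hz)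
        (fun z hz w => ?_) (ih L' (hWo.preimage (by fun_prop)) hh.dirDeriv)
      refine (hasDirDeriv_pushforward hWo hh hz (L w)).congr fun t => ?_
      simp
  exact isCkOn_top_iff.2 fun n => key n L hWo hh

end CkMap

end Pushforward

/-! ### `C^k` maps into manifolds and Lie groups -/

section IntoManifolds

variable {X : Type*} [AddCommGroup X] [Module ℝ X] [TopologicalSpace X]
  [IsTopologicalAddGroup X] [ContinuousSMul ℝ X]
  {E : Type*} [AddCommGroup E] [Module ℝ E] [TopologicalSpace E]
  [IsTopologicalAddGroup E] [ContinuousSMul ℝ E] [LocallyConvexSpace ℝ E] [T2Space E]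
  {E' : Type*} [AddCommGroup E'] [Module ℝ E'] [TopologicalSpace E']
  [IsTopologicalAddGroup E'] [ContinuousSMul ℝ E'] [LocallyConvexSpace ℝ E'] [T2Space E']
  {N : Type*} [TopologicalSpace N] [ChartedSpace E N]
  {N' : Type*} [TopologicalSpace N'] [ChartedSpace E' N']
  {k : ℕ∞} {U : Set X}

lemma isCkMapOn_from_vector_iff {c : X → N} : IsCkMapOn X E k c U ↔
    ContinuousOn c U ∧ ∀ ψ ∈ atlas E N, IsCkOn k (fun x => ψ (c x)) (U ∩ c ⁻¹' ψ.source) := by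
  constructor
  · intro h
    refine ⟨h.continuousOn, fun ψ hψ => ?_⟩
    simpa using h.isCkOn (OpenPartialHomeomorph.refl X) (by simp) ψ hψ
  · rintro ⟨h1, h2⟩
    refine ⟨h1, fun φ hφ ψ hψ => ?_⟩
    rw [chartedSpaceSelf_atlas] at hφ
    subst hφ
    simpa using h2 ψ hψ

lemma isCkMapOn_vector_vector_iff {f : X → E} : IsCkMapOn X E k f U ↔ IsCkOn k f U := by
  rw [isCkMapOn_from_vector_iff]
  refine ⟨fun h => by simpa using h.2 (OpenPartialHomeomorph.refl E) (by simp), fun h =>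
    ⟨h.continuousOn_self, fun ψ hψ => ?_⟩⟩
  rw [chartedSpaceSelf_atlas] at hψ
  subst hψ
  simpa using h

lemma IsCkMapOn.of_le {M : Type*} [TopologicalSpace M] [ChartedSpace X M] {f : M → N} {S : Set M}
    {l : ℕ∞} (hf : IsCkMapOn X E k f S) (h : l ≤ k) : IsCkMapOn X E l f S :=
  ⟨hf.continuousOn, fun φ hφ ψ hψ => (hf.isCkOn φ hφ ψ hψ).of_le h⟩

lemma IsCkMapOn.mono {M : Type*} [TopologicalSpace M] [ChartedSpace X M] {f : M → N} {S S' : Set M}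
    (hf : IsCkMapOn X E k f S) (h : S' ⊆ S) : IsCkMapOn X E k f S' :=
  ⟨hf.continuousOn.mono h, fun φ hφ ψ hψ => (hf.isCkOn φ hφ ψ hψ).mono fun _ hx =>
    ⟨hx.1, h hx.2.1, hx.2.2⟩⟩

/-- Near `x` the composite factors through the chart at `c x`, and the chain rule applies to the two
representatives. -/
lemma IsCkMapOn.comp_vector {c : X → N} {Φ : N → N'} {S : Set N} (hΦ : IsCkMapOn E E' k Φ S)
    (hc : IsCkMapOn X E k c U) (hS : IsOpen S) (hU : IsOpen U) (hmap : MapsTo c U S) :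
    IsCkMapOn X E' k (fun x => Φ (c x)) U := by
  obtain ⟨hc1, hc2⟩ := isCkMapOn_from_vector_iff.1 hc
  refine isCkMapOn_from_vector_iff.2 ⟨hΦ.continuousOn.comp hc1 hmap, fun ψ' hψ' => ?_⟩
  refine isCkOn_of_local fun x hx => ?_
  set ψ := chartAt E (c x)
  have hψ : ψ ∈ atlas E N := chart_mem_atlas E (c x)
  have hO : IsOpen (S ∩ Φ ⁻¹' ψ'.source) :=
    hΦ.continuousOn.isOpen_inter_preimage hS ψ'.open_source
  have hV : IsOpen (U ∩ c ⁻¹' (ψ.source ∩ (S ∩ Φ ⁻¹' ψ'.source))) :=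
    hc1.isOpen_inter_preimage hU (ψ.open_source.inter hO)
  refine ⟨_, hV, ⟨hx.1, mem_chart_source E (c x), hmap hx.1, hx.2⟩, ?_⟩
  refine IsCkOn.congr hV ((hΦ.isCkOn ψ hψ ψ' hψ').comp (f := fun x => ψ (c x))
    ((hc2 ψ hψ).mono fun z hz => ⟨hz.1, hz.2.1⟩) hV
    (ψ.symm.continuousOn.isOpen_inter_preimage ψ.open_target hO) fun z hz => ?_) fun z hz => ?_
  · refine ⟨ψ.map_source hz.2.1, ?_⟩
    rw [mem_preimage, ψ.left_inv hz.2.1]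
    exact hz.2.2
  · simp only [ψ.left_inv hz.2.1]

lemma IsCkMapOn.prodMk_vector {c : X → N} {d : X → N'} (hc : IsCkMapOn X E k c U)
    (hd : IsCkMapOn X E' k d U) (hU : IsOpen U) :
    letI : ChartedSpace (E × E') (N × N') := prodChartedSpace E N E' N'
    IsCkMapOn X (E × E') k (fun x => (c x, d x)) U := by
  obtain ⟨hc1, hc2⟩ := isCkMapOn_from_vector_iff.1 hc
  obtain ⟨hd1, hd2⟩ := isCkMapOn_from_vector_iff.1 hd
  let : ChartedSpace (E × E') (N × N') := prodChartedSpace E N E' N'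
  refine isCkMapOn_from_vector_iff.2 ⟨hc1.prodMk hd1, ?_⟩
  rintro _ ⟨e, he, e', he', rfl⟩
  have hV : IsOpen (U ∩ (fun x => (c x, d x)) ⁻¹' (e.prod e').source) :=
    (hc1.prodMk hd1).isOpen_inter_preimage hU (e.prod e').open_source
  exact ((hc2 e he).mono fun x hx => ⟨hx.1, hx.2.1⟩).prodMk
    ((hd2 e' he').mono fun x hx => ⟨hx.1, hx.2.2⟩) hV

/-- Reduces maps on `M` to maps on open subsets of its model space, where products and inverses in a
Lie group are handled. -/
lemma isCkMapOn_of_comp_charts_symm {M : Type*} [TopologicalSpace M] [ChartedSpace X M] {f : M → N}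
    (h : ∀ φ ∈ atlas X M, IsCkMapOn X E k (fun x => f (φ.symm x)) φ.target) :
    IsCkMapOn X E k f univ := by
  refine ⟨continuousOn_univ.2 (continuous_iff_continuousAt.2 fun m => ?_), fun φ hφ ψ hψ => ?_⟩
  · have h1 := (h _ (chart_mem_atlas X m)).continuousOn.continuousAt
      ((chartAt X m).open_target.mem_nhds (mem_chart_target X m))
    have h2 := ContinuousAt.comp (f := chartAt X m) (x := m) h1
      ((chartAt X m).continuousAt (mem_chart_source X m))
    refine h2.congr ?_
    filter_upwards [(chartAt X m).open_source.mem_nhds (mem_chart_source X m)] with m' hm'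
    simp [(chartAt X m).left_inv hm']
  · rw [univ_inter]
    exact (isCkMapOn_from_vector_iff.1 (h φ hφ)).2 ψ hψ

lemma IsCkMapOn.comp_chart_symm {M : Type*} [TopologicalSpace M] [ChartedSpace X M] {f : M → N}
    (h : IsCkMapOn X E k f univ) {φ : OpenPartialHomeomorph M X} (hφ : φ ∈ atlas X M) :
    IsCkMapOn X E k (fun x => f (φ.symm x)) φ.target :=
  isCkMapOn_from_vector_iff.2 ⟨(continuousOn_univ.1 h.continuousOn).comp_continuousOn
    φ.symm.continuousOn, fun ψ hψ => (h.isCkOn φ hφ ψ hψ).mono fun _ hx => ⟨hx.1, mem_univ _, hx.2⟩⟩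

lemma isCkMapOn_const (n : N) : IsCkMapOn X E k (fun _ : X => n) U :=
  isCkMapOn_from_vector_iff.2 ⟨continuousOn_const, fun _ _ => isCkOn_const _ _⟩

/-- A map whose representatives in all pairs of charts are `C^k` on open sets is `C^k`. -/
lemma isCkMapOn_univ_of_charts {M : Type*} [TopologicalSpace M] [ChartedSpace X M] {f : M → N}
    (ho : ∀ φ ∈ atlas X M, ∀ ψ ∈ atlas E N,
      IsOpen (φ.target ∩ φ.symm ⁻¹' (univ ∩ f ⁻¹' ψ.source)))
    (hc : ∀ φ ∈ atlas X M, ∀ ψ ∈ atlas E N, IsCkOn k (fun x => ψ (f (φ.symm x)))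
      (φ.target ∩ φ.symm ⁻¹' (univ ∩ f ⁻¹' ψ.source))) : IsCkMapOn X E k f univ := by
  refine ⟨continuousOn_univ.2 (continuous_iff_continuousAt.2 fun m => ?_), hc⟩
  set φ := chartAt X m
  set ψ := chartAt E (f m)
  have hφ : φ ∈ atlas X M := chart_mem_atlas X m
  have hψ : ψ ∈ atlas E N := chart_mem_atlas E (f m)
  have hm : m ∈ φ.source := mem_chart_source X m
  have hD := ho φ hφ ψ hψ
  have hmD : φ m ∈ φ.target ∩ φ.symm ⁻¹' (univ ∩ f ⁻¹' ψ.source) :=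
    ⟨φ.map_source hm, mem_univ _, by
      rw [mem_preimage, φ.left_inv hm]; exact mem_chart_source E (f m)⟩
  have h1 := ((hc φ hφ ψ hψ).continuousOn_self.continuousAt (hD.mem_nhds hmD))
  have h2 := ContinuousAt.comp (f := φ) (x := m) h1 (φ.continuousAt hm)
  have h3 : ContinuousAt (fun m' => ψ.symm (ψ (f (φ.symm (φ m'))))) m := by
    refine ContinuousAt.comp (g := ψ.symm) (f := fun m' => ψ (f (φ.symm (φ m')))) ?_ h2
    refine ψ.symm.continuousAt ?_
    rw [φ.left_inv hm]
    exact ψ.map_source (mem_chart_source E (f m))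
  refine h3.congr ?_
  filter_upwards [φ.open_source.mem_nhds hm, (φ.continuousAt hm).eventually (hD.mem_nhds hmD)]
    with m' hm' hm'D
  rw [ψ.left_inv hm'D.2.2, φ.left_inv hm']

end IntoManifolds

/-! ### Differential calculus with values in a Lie group -/

namespace IsLCLieGroup

variable {E : Type*} [AddCommGroup E] [Module ℝ E] [TopologicalSpace E]
  [IsTopologicalAddGroup E] [ContinuousSMul ℝ E] [LocallyConvexSpace ℝ E] [T2Space E]
  {K : Type*} [Group K] [TopologicalSpace K] [ChartedSpace E K]
  {X : Type*} [AddCommGroup X] [Module ℝ X] [TopologicalSpace X]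
  [IsTopologicalAddGroup X] [ContinuousSMul ℝ X] {k : ℕ∞} {U : Set X} {c d : X → K}

lemma isTopologicalGroup (hK : IsLCLieGroup E K) : IsTopologicalGroup K where
  continuous_mul := by
    let : ChartedSpace (E × E) (K × K) := prodChartedSpace E K E K
    exact continuousOn_univ.1 (IsCkMapOn.continuousOn hK.smooth_mul)
  continuous_inv := continuousOn_univ.1 hK.smooth_inv.continuousOn

lemma isCkMapOn_mul (hK : IsLCLieGroup E K) (hU : IsOpen U) (hc : IsCkMapOn X E k c U)
    (hd : IsCkMapOn X E k d U) : IsCkMapOn X E k (fun x => c x * d x) U := by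
  let : ChartedSpace (E × E) (K × K) := prodChartedSpace E K E K
  have hmul : IsCkMapOn (E × E) E ⊤ (fun p : K × K => p.1 * p.2) univ := hK.smooth_mul
  exact (hmul.of_le le_top).comp_vector (hc.prodMk_vector hd hU) isOpen_univ hU
    fun _ _ => mem_univ _

lemma isCkMapOn_inv (hK : IsLCLieGroup E K) (hU : IsOpen U) (hc : IsCkMapOn X E k c U) :
    IsCkMapOn X E k (fun x => (c x)⁻¹) U :=
  (hK.smooth_inv.of_le le_top).comp_vector hc isOpen_univ hU fun _ _ => mem_univ _

lemma isCkMapOn_chart_symm (hK : IsLCLieGroup E K) {ψ : OpenPartialHomeomorph K E}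
    (hψ : ψ ∈ atlas E K) : IsCkMapOn E E k ψ.symm ψ.target :=
  isCkMapOn_from_vector_iff.2
    ⟨ψ.symm.continuousOn, fun _ hψ' => (hK.smooth_compat ψ hψ _ hψ').of_le le_top⟩

end IsLCLieGroup

/-! ### The Trotter property of locally exponential groups -/

section Trotter

variable {E : Type*} [AddCommGroup E] [Module ℝ E] [TopologicalSpace E]
  {G : Type*} [Group G] [TopologicalSpace G] [ChartedSpace E G] {exp : E → G}

lemma IsExpFunction.map_zero (h : IsExpFunction exp) : exp 0 = 1 := by
  simpa using h.map_add 0 0 0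

lemma IsExpFunction.pow (h : IsExpFunction exp) (x : E) (n : ℕ) : exp x ^ n = exp ((n : ℝ) • x) := by
  induction n with
  | zero => simp [h.map_zero]
  | succ n ih => rw [pow_succ, ih, Nat.cast_succ, h.map_add, one_smul]

variable [IsTopologicalAddGroup E] [ContinuousSMul ℝ E] [LocallyConvexSpace ℝ E] [T2Space E]

lemma IsExpFunction.continuous (h : IsExpFunction exp) : Continuous exp :=
  continuousOn_univ.1 h.smooth.continuousOn

/-- The product of two one-parameter groups, in logarithmic coordinates, has the sum of the
generators as its derivative. -/
lemma IsLCLieGroup.tendsto_log_mul (hG : IsLCLieGroup E G) (hexp : IsExpFunction exp) {U : Set E}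
    (hU : IsOpen U) (h0 : (0 : E) ∈ U) (himg : IsOpen (exp '' U)) {log : G → E}
    (hlog : ∀ x ∈ U, log (exp x) = x) (hlogCk : IsCkMapOn E E ⊤ log (exp '' U)) (x y : E) :
    (∀ᶠ s : ℝ in 𝓝 0, exp (s • x) * exp (s • y) ∈ exp '' U) ∧
    Tendsto (fun s : ℝ => s⁻¹ • log (exp (s • x) * exp (s • y))) (𝓝[≠] 0) (𝓝 (x + y)) := by
  have := hG.isTopologicalGroup
  have hexpc := hexp.continuous
  have h1 : (1 : G) ∈ exp '' U := ⟨0, h0, hexp.map_zero⟩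
  have hlog1 : log 1 = 0 := by rw [← hexp.map_zero, hlog 0 h0]
  -- Two independent times: along each axis `log` inverts `exp`, so the partial derivatives of `log
  -- ∘ w` at `0` are `x` and `y`. Additivity of the derivative in its direction gives `x + y` along
  -- the diagonal.
  let w : ℝ × ℝ → G := fun s => exp (s.1 • x) * exp (s.2 • y)
  have hwc : Continuous w := by fun_prop
  have hsm : ∀ T : ℝ × ℝ →L[ℝ] E, IsCkMapOn (ℝ × ℝ) E ⊤ (fun s => exp (T s)) univ := fun T =>
    hexp.smooth.comp_vector (isCkMapOn_vector_vector_iff.2 (T.isCkOn univ)) isOpen_univ isOpen_univ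
      fun _ _ => mem_univ _
  have hw : IsCkMapOn (ℝ × ℝ) E ⊤ w univ := hG.isCkMapOn_mul isOpen_univ
    (hsm ((ContinuousLinearMap.fst ℝ ℝ ℝ).smulRight x))
    (hsm ((ContinuousLinearMap.snd ℝ ℝ ℝ).smulRight y))
  have hD : IsOpen (w ⁻¹' (exp '' U)) := himg.preimage hwc
  have h0D : (0 : ℝ × ℝ) ∈ w ⁻¹' (exp '' U) := by simpa [w, hexp.map_zero] using h1
  have hB : IsCkOn ⊤ (fun s => log (w s)) (w ⁻¹' (exp '' U)) := isCkMapOn_vector_vector_iff.1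
    (hlogCk.comp_vector (hw.mono (subset_univ _)) himg hD fun _ hs => hs)
  have hd := fun p hp h => hB.hasDirDeriv_dirDeriv le_top (x := p) hp h
  have hadd := dirDeriv_add_dir hD hd
    ((hB.of_le (le_top (a := (1 : ℕ∞)))).family (A := Unit) |>.continuousOn_dirDeriv le_rfl |>.comp
      (f := fun q : (ℝ × ℝ) × (ℝ × ℝ) => (((), q.1), q.2)) (by fun_prop)
      fun q hq => ⟨hq.1, mem_univ _⟩) h0D (1, 0) (0, 1)
  have hlin : ∀ v : E, ∀ᶠ t : ℝ in 𝓝[≠] 0, t⁻¹ • log (exp (t • v)) = v := by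
    intro v
    have : Tendsto (fun t : ℝ => 0 + t • v) (𝓝[≠] 0) (𝓝 0) := tendsto_line 0 v
    filter_upwards [this.eventually (hU.mem_nhds h0), self_mem_nhdsWithin] with t ht ht0
    rw [zero_add] at ht
    rw [hlog _ ht, smul_smul, inv_mul_cancel₀ ht0, one_smul]
  have e1 : dirDeriv (fun s => log (w s)) 0 (1, 0) = x := by
    refine HasDirDeriv.dirDeriv_eq (tendsto_const_nhds.congr' ?_)
    filter_upwards [hlin x] with t ht
    simp [w, hexp.map_zero, hlog1, ht]
  have e2 : dirDeriv (fun s => log (w s)) 0 (0, 1) = y := by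
    refine HasDirDeriv.dirDeriv_eq (tendsto_const_nhds.congr' ?_)
    filter_upwards [hlin y] with t ht
    simp [w, hexp.map_zero, hlog1, ht]
  rw [e1, e2] at hadd
  constructor
  · have hdiag : Tendsto (fun s : ℝ => (s, s)) (𝓝 0) (𝓝 (0 : ℝ × ℝ)) :=
      Continuous.tendsto' (by fun_prop) _ _ rfl
    exact hdiag.eventually (hD.mem_nhds h0D)
  · rw [← hadd]
    refine (hd 0 h0D ((1, 0) + (0, 1))).congr fun t => ?_
    simp [w, hexp.map_zero, hlog1]

/-- Every locally exponential Lie group has the Trotter property. -/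
theorem IsLCLieGroup.hasTrotterProperty (hG : IsLCLieGroup E G) (h : IsLocallyExponential E G) :
    HasTrotterProperty E G := by
  obtain ⟨exp, hexp, U, hU, h0, himg, -, log, hlog, hlogCk⟩ := h
  refine ⟨exp, hexp, fun x y S hS W hW => ?_⟩
  have := hG.isTopologicalGroup
  have hexpc := hexp.continuous
  obtain ⟨hmem, hlim⟩ := hG.tendsto_log_mul hexp hU h0 himg hlog hlogCk x y
  have hlog1 : log 1 = 0 := by rw [← hexp.map_zero, hlog 0 h0]
  -- The value `x + y` filled in at `0` makes `b` continuous there, which is all that is used.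
  let b : ℝ → E := Function.update (fun s : ℝ => s⁻¹ • log (exp (s • x) * exp (s • y))) 0 (x + y)
  have hb0 : b 0 = x + y := Function.update_self ..
  have hb : ContinuousAt b 0 := continuousAt_update_same.2 hlim
  -- Tube lemma over the compact set `S`: one neighbourhood of `s = 0` serves all `t ∈ S`. This is
  -- the source of uniformity.
  have hev : ∀ᶠ s : ℝ in 𝓝 0, ∀ t ∈ S, (exp (t • (x + y)))⁻¹ * exp (t • b s) ∈ W := by
    refine hS.eventually_forall_of_forall_eventually fun t _ => ?_
    have hc : ContinuousAt (fun z : ℝ × ℝ => (exp (z.2 • (x + y)))⁻¹ * exp (z.2 • b z.1)) (0, t) := by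
      have hb' : ContinuousAt (fun z : ℝ × ℝ => b z.1) (0, t) :=
        ContinuousAt.comp (f := Prod.fst) (g := b) hb continuousAt_fst
      refine ContinuousAt.mul (Continuous.continuousAt (by fun_prop)) ?_
      exact hexpc.continuousAt.comp (continuousAt_snd.smul hb')
    exact hc.eventually (by simpa [hb0] using hW)
  obtain ⟨δ, hδ, hball⟩ := Metric.eventually_nhds_iff.1 (hmem.and hev)
  -- `R` bounds `|t|` on `S`, so `|t / n| ≤ R / n < δ` for all `t ∈ S` once `n` is large.
  obtain ⟨R, hR⟩ := hS.isBounded.exists_norm_le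
  have hn : ∀ᶠ n : ℕ in atTop, R / (n : ℝ) < δ :=
    (tendsto_const_div_atTop_nhds_zero_nat R).eventually_lt_const hδ
  filter_upwards [hn, eventually_gt_atTop 0] with n hn hn0 t ht
  have hn0' : (0 : ℝ) < n := by exact_mod_cast hn0
  have hdist : dist (t / (n : ℝ)) 0 < δ := by
    rw [dist_zero_right, norm_div, Real.norm_of_nonneg hn0'.le]
    exact lt_of_le_of_lt (div_le_div_of_nonneg_right (hR t ht) hn0'.le) hn
  obtain ⟨⟨u, hu, hu'⟩, h2⟩ := hball hdist
  -- With `u = log (exp (t/n x) exp (t/n y))`, the power is `exp (n u)` and `n u = t b (t / n)`. The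
  -- case `t = 0` is separate because `b 0` is the filled-in value; there `u = 0`.
  have key : exp (t • b (t / n)) = (exp ((t / (n : ℝ)) • x) * exp ((t / (n : ℝ)) • y)) ^ n := by
    rw [← hu', hexp.pow]
    congr 1
    rcases eq_or_ne t 0 with rfl | ht0
    · have : u = 0 := by
        have h3 : log (exp u) = log 1 := by rw [hu']; simp [hexp.map_zero]
        rwa [hlog u hu, hlog1] at h3
      simp [this]
    · have hs : t / (n : ℝ) ≠ 0 := div_ne_zero ht0 hn0'.ne'
      rw [show b (t / n) = (t / (n : ℝ))⁻¹ • u by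
        simp only [b, Function.update_of_ne hs, ← hu', hlog u hu], smul_smul]
      congr 1
      field_simp
  rw [← key]
  exact h2 t ht

end Trotter

/-! ### Lie groups from local exponential data -/

section LocalExp

/-- A group `G` with a map `Exp : C → G` that restricts to a bijection from an open
`0`-neighbourhood `T` onto `V ⊆ G`, such that all maps `(x, y) ↦ g Exp(x) h Exp(y)` are smooth
where they take values in `V`. -/
structure LocalExpData (C : Type*) [AddCommGroup C] [Module ℝ C] [TopologicalSpace C]
    (G : Type*) [Group G] where
  Exp : C → G
  Log : G → C
  T : Set C
  V : Set G
  isOpen_T : IsOpen T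
  zero_mem : 0 ∈ T
  Exp_mem : ∀ x ∈ T, Exp x ∈ V
  Log_mem : ∀ g ∈ V, Log g ∈ T
  Log_Exp : ∀ x ∈ T, Log (Exp x) = x
  Exp_Log : ∀ g ∈ V, Exp (Log g) = g
  map_add : ∀ (x : C) (s t : ℝ), Exp ((s + t) • x) = Exp (s • x) * Exp (t • x)
  isOpen_word : ∀ g h : G, IsOpen {z : C × C | g * Exp z.1 * (h * Exp z.2) ∈ V}
  smooth_word : ∀ g h : G, IsCkOn ⊤ (fun z : C × C => Log (g * Exp z.1 * (h * Exp z.2)))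
    {z : C × C | g * Exp z.1 * (h * Exp z.2) ∈ V}

namespace LocalExpData

variable {C : Type*} [AddCommGroup C] [Module ℝ C] [TopologicalSpace C]
  [IsTopologicalAddGroup C] [ContinuousSMul ℝ C] [LocallyConvexSpace ℝ C] [T2Space C]
  {G : Type*} [Group G] (d : LocalExpData C G)

lemma Exp_zero : d.Exp 0 = 1 := by
  simpa using d.map_add 0 0 0

lemma Exp_neg (x : C) : d.Exp (-x) = (d.Exp x)⁻¹ := by
  refine eq_inv_of_mul_eq_one_left ?_
  simpa [d.Exp_zero] using (d.map_add x (-1) 1).symm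

lemma one_mem : (1 : G) ∈ d.V := d.Exp_zero ▸ d.Exp_mem 0 d.zero_mem

/-- The two-factor word covers every case: chart changes take `A = id`, `B = 0`, products the two
projections, and inversion `A = -id`, `B = 0`, because `(g Exp x)⁻¹ = Exp (-x) g⁻¹`. -/
lemma isOpen_and_isCkOn {Z : Type*} [AddCommGroup Z] [Module ℝ Z] [TopologicalSpace Z]
    [IsTopologicalAddGroup Z] [ContinuousSMul ℝ Z] {c : Z → G} (g h : G) (A B : Z →L[ℝ] C)
    (hc : ∀ z, c z = g * d.Exp (A z) * (h * d.Exp (B z))) :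
    IsOpen {z | c z ∈ d.V} ∧ IsCkOn ⊤ (fun z => d.Log (c z)) {z | c z ∈ d.V} := by
  have ho : IsOpen {z | c z ∈ d.V} := by
    simp only [hc]
    exact (d.isOpen_word g h).preimage (A.prod B).continuous
  refine ⟨ho, ?_⟩
  simp only [hc] at ho ⊢
  exact (d.smooth_word g h).comp ((A.prod B).isCkOn _) ho (d.isOpen_word g h) fun z hz => hz

lemma isOpen_and_isCkOn_left {c : C → G} (g : G) (hc : ∀ x, c x = g * d.Exp x) :
    IsOpen {x | c x ∈ d.V} ∧ IsCkOn ⊤ (fun x => d.Log (c x)) {x | c x ∈ d.V} :=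
  d.isOpen_and_isCkOn g 1 (ContinuousLinearMap.id ℝ C) 0 fun x => by simp [hc, d.Exp_zero]

/-- The chart around `g`, given by `f ↦ Log (g⁻¹ f)`. -/
def chart (g : G) : PartialEquiv G C where
  toFun f := d.Log (g⁻¹ * f)
  invFun x := g * d.Exp x
  source := {f | g⁻¹ * f ∈ d.V}
  target := d.T
  map_source' _ hf := d.Log_mem _ hf
  map_target' x hx := by simpa using d.Exp_mem x hx
  left_inv' f hf := by simp [d.Exp_Log _ hf]
  right_inv' x hx := by simp [d.Log_Exp x hx]

lemma chart_trans_source (g h : G) : ((d.chart g).symm.trans (d.chart h)).source =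
    d.T ∩ {x | h⁻¹ * (g * d.Exp x) ∈ d.V} := by
  rw [PartialEquiv.trans_source]
  rfl

/-- The atlas of left translates of `Log`. -/
def core : ChartedSpaceCore C G where
  atlas := range d.chart
  chartAt := d.chart
  mem_chart_source g := by simp [chart, d.one_mem]
  chart_mem_atlas g := mem_range_self g
  open_source := by
    rintro _ _ ⟨g, rfl⟩ ⟨h, rfl⟩
    rw [chart_trans_source]
    exact d.isOpen_T.inter (d.isOpen_and_isCkOn_left (h⁻¹ * g) fun x => by simp [mul_assoc]).1
  continuousOn_toFun := by
    rintro _ _ ⟨g, rfl⟩ ⟨h, rfl⟩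
    rw [chart_trans_source]
    exact (d.isOpen_and_isCkOn_left (c := fun x => h⁻¹ * (g * d.Exp x)) (h⁻¹ * g)
      fun x => by simp [mul_assoc]).2.continuousOn_self.mono inter_subset_right

/-- The group topology determined by the exponential data. -/
@[reducible]
def topology : TopologicalSpace G := d.core.toTopologicalSpace

/-- The manifold structure determined by the exponential data. -/
@[reducible]
def chartedSpace : @ChartedSpace C _ G d.topology := d.core.toChartedSpace

lemma exists_of_mem_atlas {φ : @OpenPartialHomeomorph G C d.topology _}
    (hφ : φ ∈ @atlas C _ G d.topology d.chartedSpace) :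
    ∃ g : G, φ = d.core.openPartialHomeomorph (d.chart g) (mem_range_self g) := by
  change φ ∈ ⋃ (e : PartialEquiv G C) (he : e ∈ d.core.atlas), {d.core.openPartialHomeomorph e he}
    at hφ
  simp only [mem_iUnion] at hφ
  obtain ⟨_, ⟨g, rfl⟩, h⟩ := hφ
  exact ⟨g, mem_singleton_iff.1 h⟩

/-- A group with local exponential data is a Lie group. -/
theorem exists_lieGroup {Q : Type*} [TopologicalSpace Q] [T2Space Q] {ev : G → Q}
    (hinj : Function.Injective ev) (hev : ∀ g : G, ContinuousOn (fun x => ev (g * d.Exp x)) d.T) :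
    ∃ (_ : TopologicalSpace G) (_ : ChartedSpace C G),
      IsLCLieGroup C G ∧ IsExpFunction d.Exp ∧ IsLocalDiffeoAtZero d.Exp := by
  let _ : TopologicalSpace G := d.topology
  let _ : ChartedSpace C G := d.chartedSpace
  have hat : ∀ φ ∈ atlas C G, ∃ g : G, (∀ f, φ f = d.Log (g⁻¹ * f)) ∧
      (∀ x, φ.symm x = g * d.Exp x) ∧ φ.source = {f | g⁻¹ * f ∈ d.V} ∧ φ.target = d.T := by
    intro φ hφ
    obtain ⟨g, hg⟩ := d.exists_of_mem_atlas hφ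
    exact ⟨g, by rw [hg]; exact fun _ => rfl, by rw [hg]; exact fun _ => rfl, by rw [hg]; rfl,
      by rw [hg]; rfl⟩
  have hchart : ∀ g : G, (chartAt C g).source = {f | g⁻¹ * f ∈ d.V} ∧
      (∀ f, chartAt C g f = d.Log (g⁻¹ * f)) ∧ (∀ x, (chartAt C g).symm x = g * d.Exp x) ∧
      (chartAt C g).target = d.T := fun g => ⟨rfl, fun _ => rfl, fun _ => rfl, rfl⟩
  -- An atlas alone does not force the Hausdorff property. It is pulled back along the injection
  -- `ev`, which is continuous because it is so in each chart.
  have hT2 : T2Space G := by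
    refine T2Space.of_injective_continuous hinj (continuous_iff_continuousAt.2 fun g => ?_)
    have hg : g ∈ (chartAt C g).source := mem_chart_source C g
    have h1 : ContinuousAt (fun x => ev ((chartAt C g).symm x)) (chartAt C g g) :=
      (hev g).continuousAt (d.isOpen_T.mem_nhds ((chartAt C g).map_source hg))
    refine (ContinuousAt.comp (f := chartAt C g) h1 ((chartAt C g).continuousAt hg)).congr ?_
    filter_upwards [(chartAt C g).open_source.mem_nhds hg] with f hf
    simp only [Function.comp_apply, (chartAt C g).left_inv hf]
  have hcompat : ∀ φ ∈ atlas C G, ∀ ψ ∈ atlas C G,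
      IsCkOn ⊤ (fun x => ψ (φ.symm x)) (φ.target ∩ φ.symm ⁻¹' ψ.source) := by
    intro φ hφ ψ hψ
    obtain ⟨g, -, hφs, -, hφt⟩ := hat φ hφ
    obtain ⟨h, hψ1, -, hψs, -⟩ := hat ψ hψ
    simp only [hφs, hφt, hψ1, hψs]
    refine (d.isOpen_and_isCkOn_left (h⁻¹ * g) fun x => ?_).2.mono fun x hx => by simpa [hφs] using hx.2
    simp [mul_assoc]
  have hLie : IsLCLieGroup C G := by
    refine ⟨hT2, hcompat, ?_, ?_⟩
    · let _ : ChartedSpace (C × C) (G × G) := prodChartedSpace C G C G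
      have key : ∀ φ ∈ atlas (C × C) (G × G), ∀ ψ ∈ atlas C G,
          IsOpen (φ.target ∩ φ.symm ⁻¹' (univ ∩ (fun p : G × G => p.1 * p.2) ⁻¹' ψ.source)) ∧
          IsCkOn ⊤ (fun x => ψ ((fun p : G × G => p.1 * p.2) (φ.symm x)))
            (φ.target ∩ φ.symm ⁻¹' (univ ∩ (fun p : G × G => p.1 * p.2) ⁻¹' ψ.source)) := by
        rintro _ ⟨φ₁, hφ₁, φ₂, hφ₂, rfl⟩ ψ hψ
        obtain ⟨g₁, -, h₁s, -, h₁t⟩ := hat φ₁ hφ₁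
        obtain ⟨g₂, -, h₂s, -, h₂t⟩ := hat φ₂ hφ₂
        obtain ⟨h, hψ1, -, hψs, -⟩ := hat ψ hψ
        have hk := d.isOpen_and_isCkOn (c := fun z : C × C => h⁻¹ * (g₁ * d.Exp z.1 * (g₂ * d.Exp z.2)))
          (h⁻¹ * g₁) g₂ (ContinuousLinearMap.fst ℝ C C) (ContinuousLinearMap.snd ℝ C C)
          fun z => by simp [mul_assoc]
        have hset : (φ₁.prod φ₂).target ∩
            (φ₁.prod φ₂).symm ⁻¹' (univ ∩ (fun p : G × G => p.1 * p.2) ⁻¹' ψ.source) =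
            d.T ×ˢ d.T ∩ {z : C × C | h⁻¹ * (g₁ * d.Exp z.1 * (g₂ * d.Exp z.2)) ∈ d.V} := by
          ext z
          simp [hψs, h₁s, h₂s, h₁t, h₂t]
        rw [hset]
        refine ⟨(d.isOpen_T.prod d.isOpen_T).inter hk.1, ?_⟩
        have hfun : (fun x => ψ ((fun p : G × G => p.1 * p.2) ((φ₁.prod φ₂).symm x))) =
            fun z : C × C => d.Log (h⁻¹ * (g₁ * d.Exp z.1 * (g₂ * d.Exp z.2))) := by
          funext z
          simp [hψ1, h₁s, h₂s]
        rw [hfun]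
        exact hk.2.mono inter_subset_right
      exact isCkMapOn_univ_of_charts (fun φ hφ ψ hψ => (key φ hφ ψ hψ).1)
        fun φ hφ ψ hψ => (key φ hφ ψ hψ).2
    · have key : ∀ φ ∈ atlas C G, ∀ ψ ∈ atlas C G,
          IsOpen (φ.target ∩ φ.symm ⁻¹' (univ ∩ (fun g : G => g⁻¹) ⁻¹' ψ.source)) ∧
          IsCkOn ⊤ (fun x => ψ ((fun g : G => g⁻¹) (φ.symm x)))
            (φ.target ∩ φ.symm ⁻¹' (univ ∩ (fun g : G => g⁻¹) ⁻¹' ψ.source)) := by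
        intro φ hφ ψ hψ
        obtain ⟨g, -, hφs, -, hφt⟩ := hat φ hφ
        obtain ⟨h, hψ1, -, hψs, -⟩ := hat ψ hψ
        have hk := d.isOpen_and_isCkOn (c := fun x : C => h⁻¹ * (g * d.Exp x)⁻¹)
          h⁻¹ g⁻¹ (-ContinuousLinearMap.id ℝ C) 0 fun z => by
            simp [mul_assoc, d.Exp_zero, d.Exp_neg]
        have hset : φ.target ∩ φ.symm ⁻¹' (univ ∩ (fun g : G => g⁻¹) ⁻¹' ψ.source) =
            d.T ∩ {x | h⁻¹ * (g * d.Exp x)⁻¹ ∈ d.V} := by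
          ext z
          simp [hψs, hφs, hφt]
        rw [hset]
        simp only [hψ1, hφs]
        exact ⟨d.isOpen_T.inter hk.1, hk.2.mono inter_subset_right⟩
      exact isCkMapOn_univ_of_charts (fun φ hφ ψ hψ => (key φ hφ ψ hψ).1)
        fun φ hφ ψ hψ => (key φ hφ ψ hψ).2
  have hExp : IsCkMapOn C C ⊤ d.Exp univ := by
    have key : ∀ φ ∈ atlas C C, ∀ ψ ∈ atlas C G,
        IsOpen (φ.target ∩ φ.symm ⁻¹' (univ ∩ d.Exp ⁻¹' ψ.source)) ∧
        IsCkOn ⊤ (fun x => ψ (d.Exp (φ.symm x)))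
          (φ.target ∩ φ.symm ⁻¹' (univ ∩ d.Exp ⁻¹' ψ.source)) := by
      intro φ hφ ψ hψ
      rw [chartedSpaceSelf_atlas] at hφ
      subst hφ
      obtain ⟨h, hψ1, -, hψs, -⟩ := hat ψ hψ
      simpa [hψ1, hψs] using d.isOpen_and_isCkOn_left (c := fun x => h⁻¹ * d.Exp x) h⁻¹ fun x => rfl
    exact isCkMapOn_univ_of_charts (fun φ hφ ψ hψ => (key φ hφ ψ hψ).1)
      fun φ hφ ψ hψ => (key φ hφ ψ hψ).2
  -- The chart at `1` is `Log` with source `V = Exp '' T`. It serves as the smooth local inverse,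
  -- and in it `Exp` is the identity near `0`, which settles the derivative condition.
  have himg : d.Exp '' d.T = (chartAt C (1 : G)).source := by
    rw [(hchart 1).1]
    ext f
    simp only [inv_one, one_mul, mem_ofPred_eq]
    exact ⟨fun ⟨x, hx, hxf⟩ => hxf ▸ d.Exp_mem x hx, fun hf => ⟨_, d.Log_mem f hf, d.Exp_Log f hf⟩⟩
  have hLog : ∀ f, chartAt C (1 : G) f = d.Log f := fun f => by simp [(hchart 1).2.1]
  refine ⟨_, _, hLie, ⟨hExp, d.map_add, fun x => ?_⟩, d.T, d.isOpen_T, d.zero_mem, ?_,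
    hExp.mono (subset_univ _), d.Log, d.Log_Exp, ?_, fun φ hφ ψ hψ => ?_⟩
  · refine ((ContinuousLinearMap.id ℝ C).hasDirDeriv 0 x).congr_of_eqOn d.isOpen_T d.zero_mem ?_
    intro y hy
    simp [hLog, d.Log_Exp y hy]
  · rw [himg]
    exact (chartAt C (1 : G)).open_source
  · rw [himg]
    exact (chartAt C (1 : G)).continuousOn.congr fun f _ => (hLog f).symm
  · rw [chartedSpaceSelf_atlas] at hψ
    subst hψ
    have h1 := hcompat φ hφ _ (chart_mem_atlas C (1 : G))
    simp only [hLog] at h1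
    rw [himg]
    exact h1.mono fun x hx => ⟨hx.1, hx.2.1⟩

end LocalExpData

end LocalExp

/-! ### Mapping groups -/

section MappingGroup

variable {F : Type*} [NormedAddCommGroup F] [NormedSpace ℝ F] [FiniteDimensional ℝ F]
  {M : Type*} [TopologicalSpace M] [ChartedSpace F M]
  {E : Type*} [AddCommGroup E] [Module ℝ E] [TopologicalSpace E]
  [IsTopologicalAddGroup E] [ContinuousSMul ℝ E] [LocallyConvexSpace ℝ E] [T2Space E]
  {K : Type*} [Group K] [TopologicalSpace K] [ChartedSpace E K] {r : ℕ∞}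

lemma IsLCLieGroup.isCkMapOn_mul_manifold (hK : IsLCLieGroup E K) {f g : M → K}
    (hf : IsCkMapOn F E r f univ) (hg : IsCkMapOn F E r g univ) :
    IsCkMapOn F E r (fun m => f m * g m) univ :=
  isCkMapOn_of_comp_charts_symm fun φ hφ =>
    hK.isCkMapOn_mul φ.open_target (hf.comp_chart_symm hφ) (hg.comp_chart_symm hφ)

/-- The pointwise group structure on `C^r(M, K)`. -/
@[reducible]
def CkMap.group (hK : IsLCLieGroup E K) : Group (CkMap F M E K r) where
  mul f g := ⟨fun m => f m * g m, hK.isCkMapOn_mul_manifold f.isCk g.isCk⟩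
  one := ⟨fun _ => 1, isCkMapOn_of_comp_charts_symm fun _ _ => isCkMapOn_const 1⟩
  inv f := ⟨fun m => (f m)⁻¹, isCkMapOn_of_comp_charts_symm fun φ hφ =>
    hK.isCkMapOn_inv φ.open_target (f.isCk.comp_chart_symm hφ)⟩
  mul_assoc _ _ _ := DFunLike.ext _ _ fun _ => mul_assoc _ _ _
  one_mul _ := DFunLike.ext _ _ fun _ => one_mul _
  mul_one _ := DFunLike.ext _ _ fun _ => mul_one _
  inv_mul_cancel _ := DFunLike.ext _ _ fun _ => inv_mul_cancel _

namespace CkMap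

/-- The pointwise exponential `ξ ↦ exp ∘ ξ`. -/
def expMap {exp : E → K} (hexp : IsExpFunction exp) (ξ : CkMap F M E E r) : CkMap F M E K r :=
  ⟨fun m => exp (ξ m), isCkMapOn_of_comp_charts_symm fun φ hφ =>
    (hexp.smooth.of_le le_top).comp_vector (ξ.isCk.comp_chart_symm hφ) isOpen_univ φ.open_target
      fun _ _ => mem_univ _⟩

@[simp] lemma expMap_apply {exp : E → K} (hexp : IsExpFunction exp) (ξ : CkMap F M E E r) (m : M) :
    expMap hexp ξ m = exp (ξ m) := rfl

/-- The pointwise logarithm `f ↦ log ∘ f` (zero if `log ∘ f` is not of class `C^r`). -/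
def logMap (log : K → E) (f : CkMap F M E K r) : CkMap F M E E r :=
  open Classical in
  if hf : IsCkMapOn F E r (fun m => log (f m)) univ then ⟨fun m => log (f m), hf⟩ else 0

lemma logMap_apply {log : K → E} {V : Set K} (hV : IsOpen V) (hlog : IsCkMapOn E E ⊤ log V)
    {f : CkMap F M E K r} (hf : ∀ m, f m ∈ V) (m : M) : logMap log f m = log (f m) := by
  have : IsCkMapOn F E r (fun m => log (f m)) univ := isCkMapOn_of_comp_charts_symm fun φ hφ =>
    (hlog.of_le le_top).comp_vector (f.isCk.comp_chart_symm hφ) hV φ.open_target fun _ _ => hf _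
  rw [logMap, dif_pos this]
  rfl

protected lemma continuous (f : CkMap F M E K r) : Continuous f :=
  continuousOn_univ.1 f.isCk.continuousOn

/-- Near a given point `f` and `g` take values in charts `ψ₁`, `ψ₂` of `K`. The `C^r` map `γ`
records their coordinates in `E × E`, and `H` sends coordinates and `y` to the logarithm of the
word, which is smooth by smoothness of the operations of `K`. All limited regularity sits in `γ`. -/
lemma isFibrewiseSmoothOn_log_word (hK : IsLCLieGroup E K) {exp : E → K}
    (hexp : IsExpFunction exp) {log : K → E} {V : Set K} (hV : IsOpen V)
    (hlog : IsCkMapOn E E ⊤ log V) (f g : CkMap F M E K r) :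
    IsFibrewiseSmoothOn F (E × E) r (fun m (y : E × E) => log (f m * exp y.1 * (g m * exp y.2)))
      {p | f p.1 * exp p.2.1 * (g p.1 * exp p.2.2) ∈ V} := by
  intro φ hφ x hx y hy
  set ψ₁ := chartAt E (f (φ.symm x))
  set ψ₂ := chartAt E (g (φ.symm x))
  have hψ₁ : ψ₁ ∈ atlas E K := chart_mem_atlas _ _
  have hψ₂ : ψ₂ ∈ atlas E K := chart_mem_atlas _ _
  have hx₁ : f (φ.symm x) ∈ ψ₁.source := mem_chart_source _ _
  have hx₂ : g (φ.symm x) ∈ ψ₂.source := mem_chart_source _ _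
  obtain ⟨hfc, hf⟩ := isCkMapOn_from_vector_iff.1 (f.isCk.comp_chart_symm hφ)
  obtain ⟨hgc, hg⟩ := isCkMapOn_from_vector_iff.1 (g.isCk.comp_chart_symm hφ)
  let w : (E × E) × (E × E) → K := fun z =>
    ψ₁.symm z.1.1 * exp z.2.1 * (ψ₂.symm z.1.2 * exp z.2.2)
  let O₀ : Set ((E × E) × (E × E)) := {z | z.1.1 ∈ ψ₁.target ∧ z.1.2 ∈ ψ₂.target}
  have hO₀ : IsOpen O₀ := (ψ₁.open_target.preimage (by fun_prop)).inter
    (ψ₂.open_target.preimage (by fun_prop))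
  have hlin : ∀ T : (E × E) × (E × E) →L[ℝ] E, IsCkMapOn ((E × E) × (E × E)) E ⊤ T O₀ := fun T =>
    isCkMapOn_vector_vector_iff.2 (T.isCkOn O₀)
  have hexp' : ∀ T : (E × E) × (E × E) →L[ℝ] E,
      IsCkMapOn ((E × E) × (E × E)) E ⊤ (fun z => exp (T z)) O₀ := fun T =>
    hexp.smooth.comp_vector (hlin T) isOpen_univ hO₀ fun _ _ => mem_univ _
  have hw : IsCkMapOn ((E × E) × (E × E)) E ⊤ w O₀ := by
    refine hK.isCkMapOn_mul hO₀ (hK.isCkMapOn_mul hO₀ ?_ ?_) (hK.isCkMapOn_mul hO₀ ?_ ?_)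
    · exact (hK.isCkMapOn_chart_symm hψ₁).comp_vector (hlin
        ((ContinuousLinearMap.fst ℝ E E).comp (ContinuousLinearMap.fst ℝ (E × E) (E × E))))
        ψ₁.open_target hO₀ fun _ hz => hz.1
    · exact hexp' ((ContinuousLinearMap.fst ℝ E E).comp (ContinuousLinearMap.snd ℝ (E × E) (E × E)))
    · exact (hK.isCkMapOn_chart_symm hψ₂).comp_vector (hlin
        ((ContinuousLinearMap.snd ℝ E E).comp (ContinuousLinearMap.fst ℝ (E × E) (E × E))))
        ψ₂.open_target hO₀ fun _ hz => hz.2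
    · exact hexp' ((ContinuousLinearMap.snd ℝ E E).comp (ContinuousLinearMap.snd ℝ (E × E) (E × E)))
  have hO : IsOpen (O₀ ∩ w ⁻¹' V) := hw.continuousOn.isOpen_inter_preimage hO₀ hV
  have hN₁ := hfc.isOpen_inter_preimage φ.open_target ψ₁.open_source
  have hN₂ := hgc.isOpen_inter_preimage φ.open_target ψ₂.open_source
  refine ⟨fun x => (ψ₁ (f (φ.symm x)), ψ₂ (g (φ.symm x))), _, O₀ ∩ w ⁻¹' V, fun z => log (w z),
    hN₁.inter hN₂, ⟨⟨hx, hx₁⟩, ⟨hx, hx₂⟩⟩, ?_, hO, ?_, ?_, ?_⟩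
  · exact ((hf ψ₁ hψ₁).mono inter_subset_left).prodMk ((hg ψ₂ hψ₂).mono inter_subset_right)
      (hN₁.inter hN₂)
  · exact isCkMapOn_vector_vector_iff.1
      (hlog.comp_vector (hw.mono inter_subset_left) hV hO fun _ hz => hz.2)
  · refine ⟨⟨ψ₁.map_source hx₁, ψ₂.map_source hx₂⟩, ?_⟩
    simp only [w, mem_preimage, ψ₁.left_inv hx₁, ψ₂.left_inv hx₂]
    exact hy
  · intro x' hx' y' _
    have e₁ : ψ₁.symm (ψ₁ (f (φ.symm x'))) = f (φ.symm x') := ψ₁.left_inv hx'.1.2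
    have e₂ : ψ₂.symm (ψ₂ (g (φ.symm x'))) = g (φ.symm x') := ψ₂.left_inv hx'.2.2
    simp only [w, e₁, e₂]

variable [CompactSpace M]

/-- The exponential data of the mapping group. -/
def localExpData (hK : IsLCLieGroup E K) {exp : E → K} (hexp : IsExpFunction exp) {U : Set E}
    (hU : IsOpen U) (h0 : (0 : E) ∈ U) (himg : IsOpen (exp '' U)) {log : K → E}
    (hlog : ∀ x ∈ U, log (exp x) = x) (hlogCk : IsCkMapOn E E ⊤ log (exp '' U)) :
    letI := CkMap.group (F := F) (M := M) (r := r) hK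
    LocalExpData (CkMap F M E E r) (CkMap F M E K r) :=
  letI := CkMap.group (F := F) (M := M) (r := r) hK
  have := hK.isTopologicalGroup
  have hWo : ∀ f g : CkMap F M E K r,
      IsOpen {p : M × E × E | f p.1 * exp p.2.1 * (g p.1 * exp p.2.2) ∈ exp '' U} := fun f g =>
    have hf := f.continuous
    have hg := g.continuous
    have hexpc := hexp.continuous
    himg.preimage (f := fun p : M × E × E => f p.1 * exp p.2.1 * (g p.1 * exp p.2.2)) (by fun_prop)
  have hopen : ∀ f g : CkMap F M E K r, IsOpen {z : CkMap F M E E r × CkMap F M E E r |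
      ∀ m, f m * exp (z.1 m) * (g m * exp (z.2 m)) ∈ exp '' U} := fun f g =>
    (isOpen_forall_mem (hWo f g)).preimage prodL.continuous
  { Exp := expMap hexp
    Log := logMap log
    T := {ξ | ∀ m, ξ m ∈ U}
    V := {f | ∀ m, f m ∈ exp '' U}
    isOpen_T := isOpen_forall_mem (hU.preimage continuous_snd)
    zero_mem := fun _ => h0
    Exp_mem := fun ξ hξ m => mem_image_of_mem exp (hξ m)
    Log_mem := fun f hf m => by
      obtain ⟨u, hu, hu'⟩ := hf m
      rwa [logMap_apply himg hlogCk hf, ← hu', hlog u hu]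
    Log_Exp := fun ξ hξ => DFunLike.ext _ _ fun m => by
      rw [logMap_apply himg hlogCk fun m => mem_image_of_mem exp (hξ m), expMap_apply,
        hlog _ (hξ m)]
    Exp_Log := fun f hf => DFunLike.ext _ _ fun m => by
      obtain ⟨u, hu, hu'⟩ := hf m
      rw [expMap_apply, logMap_apply himg hlogCk hf, ← hu', hlog u hu]
    map_add := fun ξ s t => DFunLike.ext _ _ fun m => hexp.map_add (ξ m) s t
    isOpen_word := hopen
    smooth_word := fun f g =>
      -- Where the word takes values in `exp '' U` pointwise, its logarithm coincides with the
      -- pushforward by the fibrewise logarithmic word.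
      have hh := isFibrewiseSmoothOn_log_word hK hexp himg hlogCk f g
      IsCkOn.congr (hopen f g) (isCkOn_pushforward prodL (hWo f g) hh) fun z hz =>
        DFunLike.ext _ _ fun m => (logMap_apply himg hlogCk hz m).trans
          (pushforward_apply hh (ξ := prodL z) hz m).symm }

end CkMap

/-- The mapping group `C^r(M, K)` of a locally exponential Lie group is a locally exponential Lie
group and has the Trotter property. -/
theorem exists_isMappingLieGroup (F : Type*) [NormedAddCommGroup F] [NormedSpace ℝ F]
    [FiniteDimensional ℝ F] (M : Type*) [TopologicalSpace M] [ChartedSpace F M] [CompactSpace M]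
    (hK : IsLCLieGroup E K) (r : ℕ∞) (exp : E → K) (hexp : IsExpFunction exp)
    (hloc : IsLocalDiffeoAtZero exp) :
    ∃ (_ : Group (CkMap F M E K r)) (_ : TopologicalSpace (CkMap F M E K r))
      (_ : ChartedSpace (CkMap F M E E r) (CkMap F M E K r)),
      IsMappingLieGroup (F := F) (M := M) exp r ∧
      HasTrotterProperty (CkMap F M E E r) (CkMap F M E K r) := by
  obtain ⟨U, hU, h0, himg, -, log, hlog, hlogCk⟩ := hloc
  have := hK.t2
  have := hK.isTopologicalGroup
  let _ := CkMap.group (F := F) (M := M) (r := r) hK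
  let d : LocalExpData (CkMap F M E E r) (CkMap F M E K r) :=
    CkMap.localExpData hK hexp hU h0 himg hlog hlogCk
  -- Elements of the mapping group are separated by their values, so the Hausdorff property is
  -- tested in the product space `M → K`.
  obtain ⟨_, _, hLie, hExp, hdiff⟩ := d.exists_lieGroup (Q := M → K) (ev := fun f => f)
    DFunLike.coe_injective fun f => by
      refine (continuous_pi fun m => ?_).continuousOn
      have hm : Continuous fun ξ : CkMap F M E E r => ξ m :=
        CkMap.continuous_eval.comp (by fun_prop : Continuous fun ξ : CkMap F M E E r => (ξ, m))
      exact (hexp.continuous.comp hm).const_mul (f m)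
  exact ⟨_, _, _, ⟨fun _ _ _ => rfl, hLie, d.Exp, fun _ _ => rfl, hExp, hdiff⟩,
    hLie.hasTrotterProperty ⟨d.Exp, hExp, hdiff⟩⟩

end MappingGroup

end

/-! ### The main theorem -/

theorem mainTheorem8 {E : Type*} [AddCommGroup E] [Module ℝ E] [TopologicalSpace E]
    [IsTopologicalAddGroup E] [ContinuousSMul ℝ E] [LocallyConvexSpace ℝ E] [T2Space E]
    {K : Type*} [Group K] [TopologicalSpace K] [ChartedSpace E K] (hK : IsLCLieGroup E K) :
    -- locally exponential Lie groups have the Trotter property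
    (IsLocallyExponential E K → HasTrotterProperty E K) ∧
    -- mapping groups
    (∀ (F : Type*) [NormedAddCommGroup F] [NormedSpace ℝ F] [FiniteDimensional ℝ F]
      (M : Type*) [TopologicalSpace M] [ChartedSpace F M] [IsManifold 𝓘(ℝ, F) ∞ M]
      [T2Space M] [CompactSpace M] (r : ℕ∞) (exp : E → K),
      IsExpFunction exp → IsLocalDiffeoAtZero exp →
      ∃ (_ : Group (CkMap F M E K r)) (_ : TopologicalSpace (CkMap F M E K r))
        (_ : ChartedSpace (CkMap F M E E r) (CkMap F M E K r)),
        IsMappingLieGroup (F := F) (M := M) exp r ∧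
        HasTrotterProperty (CkMap F M E E r) (CkMap F M E K r)) ∧
    -- loop groups
    (∀ (r : ℕ∞) (exp : E → K), IsExpFunction exp → IsLocalDiffeoAtZero exp →
      ∃ (_ : Group (CkMap (EuclideanSpace ℝ (Fin 1)) Circle E K r))
        (_ : TopologicalSpace (CkMap (EuclideanSpace ℝ (Fin 1)) Circle E K r))
        (_ : ChartedSpace (CkMap (EuclideanSpace ℝ (Fin 1)) Circle E E r)
          (CkMap (EuclideanSpace ℝ (Fin 1)) Circle E K r)),
        IsMappingLieGroup (F := EuclideanSpace ℝ (Fin 1)) (M := Circle) exp r ∧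
        HasTrotterProperty (CkMap (EuclideanSpace ℝ (Fin 1)) Circle E E r)
          (CkMap (EuclideanSpace ℝ (Fin 1)) Circle E K r)) := by
  refine ⟨hK.hasTrotterProperty, ?_, ?_⟩
  · intro F _ _ _ M _ _ _ _ _ r exp hexp hloc
    exact exists_isMappingLieGroup F M hK r exp hexp hloc
  · intro r exp hexp hloc
    exact exists_isMappingLieGroup (EuclideanSpace ℝ (Fin 1)) Circle hK r exp hexp hloc
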